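/- **Conventions.** For a finite set of $n$ qubits let $\mathcal P_n$ be the Pauli group (including the phases $\pm1,\pm i$). A *stabilizer group* is a subgroup $\mathcal S\le\mathcal P_n$ with $-1\notin\mathcal S$; its rank is the size of a minimal generating set. Measuring a Hermitian Pauli $p$ with outcome $m\in\{1,-1\}$ changes $\mathcal S$ as follows: if $p$ commutes with $\mathcal S$ and $\pm p\in\mathcal S$ for some sign, nothing changes (the outcome is forced); if $p$ commutes with $\mathcal S$ but $\pm p\notin\mathcal S$, the new group is $\langle mp,\mathcal S\rangle$; if $p$ anticommutes with some element of $\mathcal S$, the new group is $\langle mp,\{s\in\mathcal S: sp=ps\}\rangle$. A measurement schedule $\mathcal M=[\mathcal M_0,\mathcal M_1,\ldots]$ is a list of stabilizer groups; a finite list of length $\ell$ is repeated with period $\ell$. The instantaneous stabilizer group (ISG) $\mathcal S_t$ is trivial for $t<0$, and for $t\ge 0$ it arises from $\mathcal S_{t-1}$ by measuring a generating set of $\mathcal M_t$. The schedule is an $[[n,k,d]]$ ISG code established for $t\ge T$ if, whatever the generating sets and outcomes, for all $t\ge T$ the group $\mathcal S_t$ is a stabilizer group of rank $n-k$ with $N(\mathcal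 S_t)/\mathcal S_t\cong\mathcal P_k$, and $d$ is the minimum, over all $t\ge T$, of the weights of elements of $N(\mathcal S_t)\setminus\langle i\rangle\mathcal S_t$. It is a stabilizer code if all the $\mathcal M_t$ together generate an Abelian group, and a Floquet code of period $\ell$ if the schedule is the repetition of a list of length $\ell$ (and of no shorter one). The *ZX-diagram* of a periodic schedule of rounds, each consisting of products of $Z$s only or of products of $X$s only, is the phase-free diagram of all timesteps $t\in\mathbb Z$ with all measurements post-selected on outcome $1$: a $Z\otimes\cdots\otimes Z$ measurement is a green spider on the world-line of each qubit involved, each joined by a wire to one red spider, and an $X\otimes\cdots\otimes X$ measurement is the same with colours exchanged. Two such diagrams are *equivalent* if finitely many of the following rewrites, each applied in possibly infinitely many disjoint places at once and in either direction, lead from one to the other (scalars ignored): fusion of finite connected sets of spiders of equal colour; removal of two-legged spiders of phase $0$; copying of a one-legged spider of phase $0$ or $\pi$ through an adjacent spider of the opposite colour. **Theorem 3.1.** Let the $[[4,2,2]]$ code be given by the schedule $[\langle Z_1Z_2Z_3Z_4\rangle,\langle X_1X_2X_3X_4\rangle]$, and let the *double hexagon code*, on the twelve qubits $(i,j)$ with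 $i\in\mathbb Z/6$ and $j\in\mathbb Z/2$, be given by $[\mathcal M_0,\ldots,\mathcal M_5]$ with $$\mathcal M_t=\left\langle P_{(t,0)},\;P_{(t,1)},\;P_{(t+1,0)}P_{(t+2,0)},\;P_{(t+1,1)}P_{(t+2,1)},\;P_{(t+3,0)}P_{(t+3,1)},\;P_{(t+4,0)}P_{(t+5,0)},\;P_{(t+4,1)}P_{(t+5,1)}\right\rangle,$$ where $P=X$ if $t$ is even and $P=Z$ if $t$ is odd. Put $s_t=\prod_{a=0}^{2}P_{(t-a,0)}P_{(t-a,1)}$ with the same $P$. Then: 1. the first schedule is a stabilizer code and a $[[4,2,2]]$ ISG code, established for $t\ge1$; 2. the double hexagon code is a $[[12,2,2]]$ Floquet code of period $6$, established for $t\ge3$, and all of the Paulis listed above have weight one or two; 3. for $t\ge3$ its ISG $\mathcal S_t$ has rank $10$, and it is generated, up to signs that depend on the measurement outcomes, by the ten distinct Paulis consisting of the seven listed generators of $\mathcal M_t$ and $s_{t-1},s_{t-2},s_{t-3}$; 4. the ZX-diagrams of the two codes are equivalent. -/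

import Mathlib

/-! ## The Pauli group -/

/-- An element of the Pauli group on a finite set `Q` of qubits, written in the normal form
`i ^ phase * ∏ q, X_q ^ (x q) * Z_q ^ (z q)`. In particular `Y = i X Z`. -/
@[ext]
structure Pauli (Q : Type) where
  phase : ZMod 4
  x : Q → ZMod 2
  z : Q → ZMod 2

namespace Pauli

variable {Q : Type} [Fintype Q]

/-- The exponent of `i` picked up in `Z ^ a * X ^ b = (-1) ^ (a b) * X ^ b * Z ^ a`. -/
def swapPhase (a b : ZMod 2) : ZMod 4 := if a = 1 ∧ b = 1 then 2 else 0

theorem swapPhase_add_left (a b c : ZMod 2) :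
    swapPhase (a + b) c = swapPhase a c + swapPhase b c := by
  revert a b c; decide

theorem swapPhase_add_right (a b c : ZMod 2) :
    swapPhase a (b + c) = swapPhase a b + swapPhase a c := by
  revert a b c; decide

/-- The Pauli group of the qubits `Q`: the product of the normal forms is obtained by moving the
`Z`s of the first factor past the `X`s of the second. -/
instance : Group (Pauli Q) where
  mul p r := ⟨p.phase + r.phase + ∑ q, swapPhase (p.z q) (r.x q), p.x + r.x, p.z + r.z⟩
  one := ⟨0, 0, 0⟩
  inv p := ⟨-p.phase + ∑ q, swapPhase (p.z q) (p.x q), p.x, p.z⟩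
  mul_assoc a b c := by
    apply Pauli.ext
    · change a.phase + b.phase + ∑ q, swapPhase (a.z q) (b.x q) + c.phase
          + ∑ q, swapPhase (a.z q + b.z q) (c.x q)
        = a.phase + (b.phase + c.phase + ∑ q, swapPhase (b.z q) (c.x q))
          + ∑ q, swapPhase (a.z q) (b.x q + c.x q)
      simp only [swapPhase_add_left, swapPhase_add_right, Finset.sum_add_distrib]
      ring
    · exact add_assoc a.x b.x c.x
    · exact add_assoc a.z b.z c.z
  one_mul a := by
    apply Pauli.ext
    · change 0 + a.phase + ∑ q, swapPhase 0 (a.x q) = a.phase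
      simp [swapPhase]
    · exact zero_add a.x
    · exact zero_add a.z
  mul_one a := by
    apply Pauli.ext
    · change a.phase + 0 + ∑ q, swapPhase (a.z q) 0 = a.phase
      simp [swapPhase]
    · exact add_zero a.x
    · exact add_zero a.z
  inv_mul_cancel a := by
    apply Pauli.ext
    · change -a.phase + ∑ q, swapPhase (a.z q) (a.x q) + a.phase
          + ∑ q, swapPhase (a.z q) (a.x q) = 0
      have h : ∑ q, swapPhase (a.z q) (a.x q) + ∑ q, swapPhase (a.z q) (a.x q) = 0 := by
        rw [← Finset.sum_add_distrib]
        refine Finset.sum_eq_zero fun q _ => ?_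
        generalize a.z q = u
        generalize a.x q = v
        revert u v; decide
      calc -a.phase + ∑ q, swapPhase (a.z q) (a.x q) + a.phase
            + ∑ q, swapPhase (a.z q) (a.x q)
          = ∑ q, swapPhase (a.z q) (a.x q) + ∑ q, swapPhase (a.z q) (a.x q) := by ring
        _ = 0 := h
    · exact funext fun q => CharTwo.add_self_eq_zero (a.x q)
    · exact funext fun q => CharTwo.add_self_eq_zero (a.z q)

instance : Finite (Pauli Q) :=
  Finite.of_injective (fun p : Pauli Q => (p.phase, p.x, p.z)) fun p r h => by
    simp only [Prod.mk.injEq] at h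
    exact Pauli.ext h.1 h.2.1 h.2.2

/-- The scalar `i`. -/
def imag : Pauli Q := ⟨1, 0, 0⟩

/-- `-p`, that is `i ^ 2 * p`. -/
instance : Neg (Pauli Q) := ⟨fun p => ⟨p.phase + 2, p.x, p.z⟩⟩

/-- `m p` for a sign `m`, such as a measurement outcome. -/
def signed (m : ℤˣ) (p : Pauli Q) : Pauli Q := if m = 1 then p else -p

/-- The number of tensor factors that are not the identity. -/
def weight (p : Pauli Q) : ℕ := (Finset.univ.filter fun q => p.x q ≠ 0 ∨ p.z q ≠ 0).card

/-- The `2 ^ |Q|`-dimensional complex matrix denoted by the normal form: it maps the basis vector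
`c` to `i ^ phase * (-1) ^ (z · c)` times the basis vector `c + x`. -/
noncomputable def toMatrix (p : Pauli Q) : Matrix (Q → ZMod 2) (Q → ZMod 2) ℂ :=
  Matrix.of fun r c =>
    if r = c + p.x then Complex.I ^ (p.phase + ∑ q, swapPhase (p.z q) (c q)).val else 0

theorem I_pow_val_add (a b : ZMod 4) :
    Complex.I ^ (a + b).val = Complex.I ^ a.val * Complex.I ^ b.val := by
  rw [← pow_add, ZMod.val_add, ← Complex.I_pow_eq_pow_mod]

/-- The group law is the multiplication of the matrices denoted. -/
theorem toMatrix_mul [DecidableEq Q] (p r : Pauli Q) :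
    (p * r).toMatrix = p.toMatrix * r.toMatrix := by
  ext a c
  rw [Matrix.mul_apply, Finset.sum_eq_single (c + r.x)]
  · have h1 : (p * r).x = p.x + r.x := rfl
    have h2 : (p * r).z = p.z + r.z := rfl
    have h3 : (p * r).phase = p.phase + r.phase + ∑ q, swapPhase (p.z q) (r.x q) := rfl
    simp only [toMatrix, Matrix.of_apply, h1, h2, h3, Pi.add_apply, swapPhase_add_left,
      swapPhase_add_right, Finset.sum_add_distrib, if_true]
    have e : c + (p.x + r.x) = c + r.x + p.x := by ring
    rw [e]
    split_ifs with h
    · rw [← I_pow_val_add]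
      congr 2
      ring
    · simp
  · intro b _ hb
    simp [toMatrix, hb]
  · simp

end Pauli

/-! ## Stabilizer groups, measurement and ISG codes -/

section ISG

variable {Q : Type} [Fintype Q]

/-- A stabilizer group is a subgroup of the Pauli group that does not contain `-1`. -/
def IsStabilizerGroup (S : Subgroup (Pauli Q)) : Prop := (-1 : Pauli Q) ∉ S

/-- The effect on the stabilizer group `S` of measuring the Hermitian Pauli `p` with outcome `m`.
If `p` commutes with `S` and `p ∈ S` or `-p ∈ S`, then the outcome is forced and nothing changes.
If `p` commutes with `S` otherwise, then `m p` is added to `S`. If `p` anticommutes with some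
element of `S`, then `m p` is added to the elements of `S` that commute with `p`. -/
noncomputable def measurePauli (S : Subgroup (Pauli Q)) (p : Pauli Q) (m : ℤˣ) : Subgroup (Pauli Q) :=
  open Classical in
  if ∀ s ∈ S, Commute p s then
    if p ∈ S ∨ -p ∈ S then S else Subgroup.closure {p.signed m} ⊔ S
  else Subgroup.closure {p.signed m} ⊔ (S ⊓ Subgroup.centralizer {p})

/-- Measuring the Paulis of a list one after the other; `m j` is the outcome of the `j`-th. -/
noncomputable def measureList :
    Subgroup (Pauli Q) → List (Pauli Q) → (ℕ → ℤˣ) → Subgroup (Pauli Q)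
  | S, [], _ => S
  | S, p :: l, m => measureList (measurePauli S p (m 0)) l fun j => m (j + 1)

/-- A run of the measurement schedule `M = [M 0, M 1, ...]`: at every timestep `t` a choice of an
(ordered) generating set of `M t`, whose elements get measured, and the measurement outcomes. -/
structure Run (M : ℕ → Subgroup (Pauli Q)) where
  gens : ℕ → List (Pauli Q)
  closure_gens : ∀ t, Subgroup.closure {p | p ∈ gens t} = M t
  outcome : ℕ → ℕ → ℤˣ

/-- The stabilizer group after the first `j` timesteps (the timesteps `0, ..., j - 1`). -/
noncomputable def Run.after {M : ℕ → Subgroup (Pauli Q)} (ρ : Run M) : ℕ → Subgroup (Pauli Q)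
  | 0 => ⊥
  | j + 1 => measureList (ρ.after j) (ρ.gens j) (ρ.outcome j)

/-- The instantaneous stabilizer group at time `t`; it is trivial for `t < 0`. -/
noncomputable def Run.isg {M : ℕ → Subgroup (Pauli Q)} (ρ : Run M) (t : ℤ) :
    Subgroup (Pauli Q) := ρ.after (t + 1).toNat

/-- The logical Pauli group `N(S) / S`. -/
abbrev LogicalPauliGroup (S : Subgroup (Pauli Q)) : Type :=
  ↥(Subgroup.normalizer (S : Set (Pauli Q))) ⧸
    S.subgroupOf (Subgroup.normalizer (S : Set (Pauli Q)))

/-- Representatives of nontrivial elements of `N(S) / S`, that is of elements other than the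
scalars `1, i, -1, -i`. -/
def nontrivialLogicals (S : Subgroup (Pauli Q)) : Set (Pauli Q) :=
  {p | p ∈ Subgroup.normalizer (S : Set (Pauli Q)) ∧ p ∉ Subgroup.closure {Pauli.imag} ⊔ S}

/-- The schedule `M` is an ISG code with parameters `[[n, k, d]]` that is established for `t ≥ T`.
This holds whatever generating sets get measured and whatever the measurement outcomes are. The
weight of an element of `N(S) / S` is the least weight of its representatives, so the distance is
the least weight of a representative of a nontrivial element, over all `t ≥ T`. -/
def IsISGCode (M : ℕ → Subgroup (Pauli Q)) (T : ℕ) (n k d : ℕ) : Prop :=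
  Fintype.card Q = n ∧
  (∀ t, IsStabilizerGroup (M t)) ∧
  ∀ ρ : Run M,
    (∀ t : ℤ, T ≤ t →
      IsStabilizerGroup (ρ.isg t) ∧
      Group.rank (ρ.isg t) + k = n ∧
      Nonempty (LogicalPauliGroup (ρ.isg t) ≃* Pauli (Fin k))) ∧
    IsLeast {w | ∃ t : ℤ, T ≤ t ∧ ∃ p ∈ nontrivialLogicals (ρ.isg t), p.weight = w} d

/-- A stabilizer code: all measurements of the schedule generate an Abelian group. -/
def IsStabilizerSchedule (M : ℕ → Subgroup (Pauli Q)) : Prop :=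
  ∀ a ∈ ⨆ t, M t, ∀ b ∈ ⨆ t, M t, a * b = b * a

/-- The schedule is the periodic repetition of a finite list of length `ℓ`, and of no shorter
one. An ISG code with such a schedule is a Floquet code. -/
def HasPeriod (M : ℕ → Subgroup (Pauli Q)) (ℓ : ℕ) : Prop :=
  IsLeast {j | 0 < j ∧ ∀ t, M (t + j) = M t} ℓ

end ISG

/-! ## CSS measurement schedules -/

/-- The two Pauli bases; also the two colours of spiders (`Z` is green, `X` is red). -/
inductive Basis
  | X
  | Z

/-- The opposite basis. -/
def Basis.flip : Basis → Basis
  | .X => .Z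
  | .Z => .X

open Classical in
/-- The Pauli `∏ q ∈ S, X_q` or `∏ q ∈ S, Z_q`. -/
noncomputable def Basis.pauli {Q : Type} (b : Basis) (S : Finset Q) : Pauli Q :=
  match b with
  | .X => ⟨0, fun q => if q ∈ S then 1 else 0, 0⟩
  | .Z => ⟨0, 0, fun q => if q ∈ S then 1 else 0⟩

/-- One timestep of a CSS schedule: the products of `X`s, or the products of `Z`s, over the given
sets of qubits get measured. -/
structure CSSRound (Q : Type) where
  basis : Basis
  supports : Finset (Finset Q)

/-- The Paulis that get measured. -/
def CSSRound.paulis {Q : Type} (R : CSSRound Q) : Set (Pauli Q) :=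
  {p | ∃ S ∈ R.supports, p = R.basis.pauli S}

/-- The schedule `[M 0, ..., M (ℓ - 1)]` with subscripts modulo `ℓ`, where `M t` is generated by
the Paulis of the `t`-th round. -/
def cssSchedule {Q : Type} [Fintype Q] {ℓ : ℕ} (R : ZMod ℓ → CSSRound Q) (t : ℕ) :
    Subgroup (Pauli Q) := Subgroup.closure (R t).paulis

/-! ## ZX-diagrams -/

/-- A ZX-diagram with spiders, open ends labelled by `B` (the inputs and outputs) and no Hadamard
boxes, given by its half-wires: `node` is the end at which a half-wire is attached, and `mate` is
the other half of its wire. Infinitely many spiders are allowed, but each has finitely many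
legs. Spiders of colour `Z` are the green ones and spiders of colour `X` the red ones. -/
structure ZXDiagram (B : Type) where
  Spider : Type
  Leg : Type
  colour : Spider → Basis
  phase : Spider → Real.Angle
  node : Leg → Spider ⊕ B
  mate : Leg → Leg
  mate_mate : ∀ l, mate (mate l) = l
  mate_ne : ∀ l, mate l ≠ l
  finite_legs : ∀ v, {l | node l = .inl v}.Finite
  open_ends : ∀ b, ∃! l, node l = .inr b

namespace ZXDiagram

variable {B : Type}

/-- Spider fusion: `D'` arises from `D` by fusing each of some disjoint, finite, connected sets of
spiders of equal colour into one spider. The wires along which they get fused disappear, all other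
wires stay, and the phases add up. -/
structure SpiderFusion (D D' : ZXDiagram B) where
  spider : D.Spider → D'.Spider
  leg : D'.Leg → D.Leg
  spider_surjective : Function.Surjective spider
  leg_injective : Function.Injective leg
  mate_leg : ∀ l, D.mate (leg l) = leg (D'.mate l)
  node_leg : ∀ l, D'.node l = Sum.map spider id (D.node (leg l))
  colour_spider : ∀ v, D'.colour (spider v) = D.colour v
  finite_fibre : ∀ w, {v | spider v = w}.Finite
  phase_eq : ∀ w, D'.phase w = ∑ᶠ v ∈ {v | spider v = w}, D.phase v
  removed : ∀ l, l ∉ Set.range leg →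
    ∃ u v, D.node l = .inl u ∧ D.node (D.mate l) = .inl v ∧ spider u = spider v
  connected : ∀ u v, spider u = spider v → Relation.ReflTransGen
    (fun a b => ∃ l, l ∉ Set.range leg ∧ D.node l = .inl a ∧ D.node (D.mate l) = .inl b) u v

/-- Identity removal: `D'` arises from `D` by replacing each of some pairwise non-adjacent spiders
with two legs and phase `0` by a plain wire. -/
structure IdentityRemoval (D D' : ZXDiagram B) where
  spider : D'.Spider → D.Spider
  leg : D'.Leg → D.Leg
  spider_injective : Function.Injective spider
  leg_injective : Function.Injective leg
  colour_spider : ∀ v, D.colour (spider v) = D'.colour v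
  phase_spider : ∀ v, D.phase (spider v) = D'.phase v
  node_leg : ∀ l, D.node (leg l) = Sum.map spider id (D'.node l)
  mate_leg : ∀ l, D.mate (leg l) ∈ Set.range leg → D.mate (leg l) = leg (D'.mate l)
  removed_leg : ∀ l, l ∉ Set.range leg → ∃ v, v ∉ Set.range spider ∧ D.node l = .inl v
  removed_spider : ∀ v, v ∉ Set.range spider → D.phase v = 0 ∧
    ∃ l₁ l₂, l₁ ≠ l₂ ∧ (∀ l, D.node l = .inl v ↔ l = l₁ ∨ l = l₂) ∧
      ∃ m₁ m₂, D.mate l₁ = leg m₁ ∧ D.mate l₂ = leg m₂ ∧ D'.mate m₁ = m₂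

/-- State copying: some one-legged spiders of phase `0` or `π` (their legs are `states`), each
attached to a spider `v` of the opposite colour, different ones to different spiders, are copied
through these spiders. That is, the one-legged spider and `v` disappear, and each other leg of `v`
ends at its own copy of the one-legged spider. The map `origin` sends a copy to `v`, and any other
spider of `D'` to the same spider in `D`. -/
structure StateCopy (D D' : ZXDiagram B) where
  states : Set D.Leg
  origin : D'.Spider → D.Spider
  leg : D'.Leg → D.Leg
  leg_injective : Function.Injective leg
  mate_leg : ∀ l, D.mate (leg l) = leg (D'.mate l)
  node_leg : ∀ l, D.node (leg l) = Sum.map origin id (D'.node l)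
  range_leg : ∀ l, l ∈ Set.range leg ↔ l ∉ states ∧ D.mate l ∉ states
  mate_states : ∀ l ∈ states, D.mate l ∉ states
  states_unique : ∀ l ∈ states, ∀ m ∈ states, D.node (D.mate l) = D.node (D.mate m) → l = m
  copied : ∀ l ∈ states, ∃ s v, D.node l = .inl s ∧ D.node (D.mate l) = .inl v ∧
    (∀ m, D.node m = .inl s → m = l) ∧ D.colour v = (D.colour s).flip ∧ 2 • D.phase s = 0 ∧
    (∀ w, origin w ≠ s) ∧
    ∀ w, origin w = v → D'.colour w = D.colour s ∧ D'.phase w = D.phase s ∧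
      ∃! m, D'.node m = .inl w
  unchanged : ∀ u, (∀ l ∈ states, D.node l ≠ .inl u ∧ D.node (D.mate l) ≠ .inl u) →
    ∃ w, (∀ w', origin w' = u ↔ w' = w) ∧ D'.colour w = D.colour u ∧ D'.phase w = D.phase u

/-- Two ZX-diagrams are equivalent if finitely many of the above rewrites (each of which may be
applied in many disjoint places at once, and backwards) lead from one to the other. Nonzero scalar
factors are ignored. Diagrams that differ by a relabelling of spiders and legs are equivalent, by a
spider fusion in which nothing gets fused. -/
def Equivalent (D D' : ZXDiagram B) : Prop :=
  Relation.EqvGen (fun E E' : ZXDiagram B =>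
    Nonempty (SpiderFusion E E') ∨ Nonempty (IdentityRemoval E E') ∨ Nonempty (StateCopy E E'))
    D D'

end ZXDiagram

/-! ## The ZX-diagram of a CSS schedule -/

section Diagram

variable {Q : Type} {ℓ : ℕ}

/-- The spiders of the diagram of a schedule: one spider on the world-line of each qubit `q` at
each timestep `t`, and one spider `outcome` for each measurement. -/
inductive CSSSpider (R : ZMod ℓ → CSSRound Q) : Type
  | qubit (t : ℤ) (q : Q)
  | outcome (t : ℤ) (S : Finset Q) (hS : S ∈ (R t).supports)

/-- The half-wires of the diagram of a schedule: the world-line of `q` enters the spider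
`qubit t q` at `below t q` and leaves it at `above t q`. The wire that joins `qubit t q` to the
measurement of `S` at time `t`, where `q ∈ S`, consists of an `inner` half at the former and an
`outer` half at the latter. -/
inductive CSSLeg (R : ZMod ℓ → CSSRound Q) : Type
  | below (t : ℤ) (q : Q)
  | above (t : ℤ) (q : Q)
  | inner (t : ℤ) (S : Finset Q) (hS : S ∈ (R t).supports) (q : Q) (hq : q ∈ S)
  | outer (t : ℤ) (S : Finset Q) (hS : S ∈ (R t).supports) (q : Q) (hq : q ∈ S)

namespace CSSLeg

variable {R : ZMod ℓ → CSSRound Q}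

/-- The spider at which a half-wire is attached. -/
def spider : CSSLeg R → CSSSpider R
  | below t q => .qubit t q
  | above t q => .qubit t q
  | inner t _ _ q _ => .qubit t q
  | outer t S hS _ _ => .outcome t S hS

/-- The other half of a wire. -/
def mate : CSSLeg R → CSSLeg R
  | below t q => above (t - 1) q
  | above t q => below (t + 1) q
  | inner t S hS q hq => outer t S hS q hq
  | outer t S hS q hq => inner t S hS q hq

theorem finite_spider [Finite Q] (v : CSSSpider R) : {l : CSSLeg R | l.spider = v}.Finite := by
  classical
  cases v with
  | qubit t q =>
    have h : {l : CSSLeg R | l.spider = .qubit t q} ⊆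
        {below t q, above t q} ∪ Set.range
          (fun a : {a : {S // S ∈ (R t).supports} // q ∈ a.1} =>
            (inner t a.1.1 a.1.2 q a.2 : CSSLeg R)) := by
      rintro (⟨t', q'⟩ | ⟨t', q'⟩ | ⟨t', S, hS, q', hq⟩ | ⟨t', S, hS, q', hq⟩) h
      · cases h; simp
      · cases h; simp
      · cases h; exact Or.inr ⟨⟨⟨S, hS⟩, hq⟩, rfl⟩
      · cases h
    exact ((Set.toFinite _).union (Set.finite_range _)).subset h
  | outcome t S hS =>
    have h : {l : CSSLeg R | l.spider = .outcome t S hS} ⊆ Set.range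
        (fun a : {q // q ∈ S} => (outer t S hS a.1 a.2 : CSSLeg R)) := by
      rintro (⟨t', q'⟩ | ⟨t', q'⟩ | ⟨t', S', hS', q', hq⟩ | ⟨t', S', hS', q', hq⟩) h
      · cases h
      · cases h
      · cases h
      · cases h; exact ⟨⟨_, hq⟩, rfl⟩
    exact (Set.finite_range _).subset h

end CSSLeg

/-- The ZX-diagram of all timesteps `t ∈ ℤ` of a CSS schedule of period `ℓ`, all measurements being
post-selected on the outcome `1`. A `Z ⊗ ... ⊗ Z` measurement consists of a green spider on the
world-line of each qubit involved, all joined to a red spider, and an `X ⊗ ... ⊗ X` measurement is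
the same with the colours exchanged. All phases are `0`. (If a qubit is not measured at time `t`,
the spider on its world-line has two legs, so it is an identity wire.) -/
noncomputable def cssDiagram [Finite Q] (R : ZMod ℓ → CSSRound Q) : ZXDiagram Empty where
  Spider := CSSSpider R
  Leg := CSSLeg R
  colour
    | .qubit t _ => (R t).basis
    | .outcome t _ _ => (R t).basis.flip
  phase _ := 0
  node l := .inl l.spider
  mate := CSSLeg.mate
  mate_mate l := by cases l <;> simp [CSSLeg.mate]
  mate_ne l := by cases l <;> simp [CSSLeg.mate]
  finite_legs v := by simpa using CSSLeg.finite_spider v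
  open_ends b := b.elim

end Diagram

/-! ## The two codes -/

/-- The `[[4,2,2]]` code: the measurements of `Z₁Z₂Z₃Z₄` and `X₁X₂X₃X₄` alternate. -/
def code422 (t : ZMod 2) : CSSRound (Fin 4) where
  basis := if t = 0 then .Z else .X
  supports := {Finset.univ}

/-- The basis of the `t`-th round of the double hexagon code: `X` if `t` is even and `Z` if `t` is
odd. -/
def hexBasis (t : ZMod 6) : Basis := if Even t.val then .X else .Z

/-- The double hexagon code on the qubits `(i, j)`, `i` modulo `6` and `j` modulo `2`. -/
def doubleHexagon (t : ZMod 6) : CSSRound (ZMod 6 × ZMod 2) where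
  basis := hexBasis t
  supports :=
    {{(t, 0)}, {(t, 1)},
      {(t + 1, 0), (t + 2, 0)}, {(t + 1, 1), (t + 2, 1)},
      {(t + 3, 0), (t + 3, 1)},
      {(t + 4, 0), (t + 5, 0)}, {(t + 4, 1), (t + 5, 1)}}

/-- The Pauli `s_t` of weight six. -/
noncomputable def hexStabilizer (t : ZMod 6) : Pauli (ZMod 6 × ZMod 2) :=
  (hexBasis t).pauli
    {(t, 0), (t, 1), (t - 1, 0), (t - 1, 1), (t - 2, 0), (t - 2, 1)}

/-! Modulo phases the Pauli group is the space `SympSpace` over the field with two elements, and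
`sympForm` decides commutation. A stabilizer group contains at most one sign of each Pauli, so `vec`
is injective on it: its rank is a dimension and its normalizer is given by the symplectic
complement. Measuring commuting Paulis with span `N` turns the image `L` into `N ⊔ (L ⊓ sympPerp N)`
(`measureList_spec`), whatever the order, generating set and outcomes. For alternating rounds of
`X`s and `Z`s this becomes the recursion `cssParts` on two binary codes, after which rank, logical
group and distance are linear algebra (`isISGCode_two`).

For the double hexagon code, `s_t` is a product of measurements of round `t`, commutes with rounds
`t + 1`, `t + 3`, and is of the same type as round `t + 2`; so it stays for three further rounds.
Conversely, of the stabilizers of the type measured at time `t`, only the span of `s_t` and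
`s_{t-2}` survives round `t + 1` (`inf_dotPerp_le`). Hence for `t ≥ 3` the two parts have dimensions
`7 + 1` and `2`. Explicit dual bases supply the two logical qubits, and the distance is a finite
check.

For the diagrams, the outcome spiders of weight-two measurements are identity wires. Every six
timesteps a qubit is measured alone, and copying that one-legged spider cuts the world-line. The
piece of `(s, j)` carries five spiders, at times `s + 1, ..., s + 5`. Its cut ends have the colours
of the outermost two and fuse into them, leaving these two-legged; the middle spiders of the pieces
`(s, 0)` and `(s, 1)` fuse into one. That spider has four neighbours of the opposite colour, the
second and fourth spiders of both pieces: it is the outcome of a weight-four measurement. The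
two-legged spiders link these neighbours for consecutive `s` into four world-lines. This is the
diagram of the `[[4,2,2]]` code, with `s` as its time. -/

open scoped Matrix

/-! ## The symplectic space of the Pauli group -/

/-- The embedding of `ZMod 2` in `ZMod 4`. -/
def doubling : ZMod 2 →+ ZMod 4 where
  toFun a := if a = 1 then 2 else 0
  map_zero' := by decide
  map_add' := by decide

theorem doubling_eq_zero {a : ZMod 2} : doubling a = 0 ↔ a = 0 := by revert a; decide

/-- The space of the exponents of `X` and `Z` of Paulis. -/
abbrev SympSpace (Q : Type) : Type := (Q → ZMod 2) × (Q → ZMod 2)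

section SympForm

variable {Q : Type} [Fintype Q]

/-- The symplectic form, which tells whether two Paulis commute. -/
def sympForm (v w : SympSpace Q) : ZMod 2 := v.1 ⬝ᵥ w.2 + v.2 ⬝ᵥ w.1

theorem sympForm_comm (v w : SympSpace Q) : sympForm v w = sympForm w v := by
  simp [sympForm, dotProduct_comm, add_comm]

theorem sympForm_add_right (v w u : SympSpace Q) :
    sympForm v (w + u) = sympForm v w + sympForm v u := by
  simp [sympForm]; ring

theorem sympForm_smul_right (c : ZMod 2) (v w : SympSpace Q) :
    sympForm v (c • w) = c * sympForm v w := by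
  simp [sympForm]; ring

/-- The symplectic complement. -/
def sympPerp (L : Submodule (ZMod 2) (SympSpace Q)) : Submodule (ZMod 2) (SympSpace Q) where
  carrier := {v | ∀ w ∈ L, sympForm w v = 0}
  zero_mem' := by simp [sympForm]
  add_mem' ha hb w hw := by rw [sympForm_add_right, ha w hw, hb w hw, add_zero]
  smul_mem' c v hv w hw := by rw [sympForm_smul_right, hv w hw, mul_zero]

theorem mem_sympPerp {L : Submodule (ZMod 2) (SympSpace Q)} {v : SympSpace Q} :
    v ∈ sympPerp L ↔ ∀ w ∈ L, sympForm w v = 0 := Iff.rfl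

theorem sympPerp_span (T : Set (SympSpace Q)) {v : SympSpace Q} :
    v ∈ sympPerp (Submodule.span (ZMod 2) T) ↔ ∀ w ∈ T, sympForm w v = 0 := by
  constructor
  · exact fun h w hw => h w (Submodule.subset_span hw)
  · intro h
    have : Submodule.span (ZMod 2) T ≤ sympPerp (Submodule.span (ZMod 2) {v}) := by
      rw [Submodule.span_le]
      intro w hw u hu
      obtain ⟨c, rfl⟩ := Submodule.mem_span_singleton.1 hu
      rw [sympForm_comm, sympForm_smul_right, h w hw, mul_zero]
    intro w hw
    rw [sympForm_comm]
    exact this hw v (Submodule.mem_span_singleton_self v)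

theorem sympPerp_anti {L L' : Submodule (ZMod 2) (SympSpace Q)} (h : L ≤ L') :
    sympPerp L' ≤ sympPerp L := fun _ hv w hw => hv w (h hw)

theorem sympPerp_sup (L L' : Submodule (ZMod 2) (SympSpace Q)) :
    sympPerp (L ⊔ L') = sympPerp L ⊓ sympPerp L' := by
  apply le_antisymm
  · exact le_inf (sympPerp_anti le_sup_left) (sympPerp_anti le_sup_right)
  · rintro v ⟨h, h'⟩ w hw
    obtain ⟨a, ha, b, hb, rfl⟩ := Submodule.mem_sup.1 hw
    rw [sympForm_comm, sympForm_add_right, sympForm_comm v, sympForm_comm v, h a ha, h' b hb,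
      add_zero]

end SympForm

/-! ### Commutation, squares and signs of Paulis -/

namespace Pauli

variable {Q : Type}

/-- The exponents of `X` and `Z`. -/
def vec (p : Pauli Q) : SympSpace Q := (p.x, p.z)

/-- The scalar `i ^ c`. -/
def scalar (c : ZMod 4) : Pauli Q := ⟨c, 0, 0⟩

theorem neg_def (p : Pauli Q) : -p = ⟨p.phase + 2, p.x, p.z⟩ := rfl

@[simp] theorem vec_neg (p : Pauli Q) : (-p).vec = p.vec := rfl

@[simp] theorem vec_signed (m : ℤˣ) (p : Pauli Q) : (p.signed m).vec = p.vec := by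
  unfold signed; split_ifs <;> rfl

protected theorem neg_neg (p : Pauli Q) : - -p = p := by
  simp only [neg_def]
  ext <;> simp [add_assoc, show (2 + 2 : ZMod 4) = 0 from by decide]

theorem signed_eq_or (m : ℤˣ) (p : Pauli Q) : p.signed m = p ∨ p.signed m = -p := by
  unfold signed; split_ifs <;> simp

variable [Fintype Q]

theorem mul_def (p r : Pauli Q) :
    p * r = ⟨p.phase + r.phase + doubling (p.z ⬝ᵥ r.x), p.x + r.x, p.z + r.z⟩ := by
  change (⟨_, _, _⟩ : Pauli Q) = _
  congr 2
  simp only [dotProduct, map_sum]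
  refine Finset.sum_congr rfl fun q _ => ?_
  generalize p.z q = a
  generalize r.x q = b
  revert a b; decide

theorem one_def : (1 : Pauli Q) = ⟨0, 0, 0⟩ := rfl

theorem neg_one_def : (-1 : Pauli Q) = ⟨2, 0, 0⟩ := by
  rw [neg_def, one_def]; simp

@[simp] theorem vec_mul (p r : Pauli Q) : (p * r).vec = p.vec + r.vec := rfl

@[simp] theorem vec_one : (1 : Pauli Q).vec = 0 := rfl

theorem neg_eq (p : Pauli Q) : -p = -1 * p := by
  rw [neg_one_def, mul_def, neg_def]
  ext <;> simp [add_comm]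

theorem scalar_mul (c : ZMod 4) (p : Pauli Q) : scalar c * p = ⟨c + p.phase, p.x, p.z⟩ := by
  rw [scalar, mul_def]; ext <;> simp

theorem mul_scalar (c : ZMod 4) (p : Pauli Q) : p * scalar c = scalar c * p := by
  rw [scalar_mul, scalar, mul_def]; ext <;> simp [add_comm]

theorem exists_scalar_mul_of_vec_eq {p r : Pauli Q} (h : p.vec = r.vec) :
    ∃ c, p = scalar c * r := by
  refine ⟨p.phase - r.phase, ?_⟩
  rw [scalar_mul]
  simp only [vec, Prod.mk.injEq] at h
  ext1
  · simp
  · exact h.1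
  · exact h.2

/-- Reordering changes only the phase, by `doubling` of the number of `Z`s that cross an `X`; the
form compares the two crossing numbers modulo two. -/
theorem commute_iff (p r : Pauli Q) : Commute p r ↔ sympForm p.vec r.vec = 0 := by
  have h : sympForm p.vec r.vec = r.z ⬝ᵥ p.x - p.z ⬝ᵥ r.x := by
    rw [sub_eq_add_neg, ZModModule.neg_eq_self, sympForm]
    simp [vec, dotProduct_comm]
  rw [Commute, SemiconjBy, mul_def, mul_def, h, sub_eq_zero]
  simp only [Pauli.mk.injEq, add_comm p.x, add_comm p.z, and_true, add_comm p.phase,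
    add_right_inj]
  rw [← sub_eq_zero, ← map_sub, doubling_eq_zero, sub_eq_zero, eq_comm]

theorem mul_eq_neg_of_not_commute {p r : Pauli Q} (h : ¬ Commute p r) : p * r = -(r * p) := by
  rw [commute_iff] at h
  have h : p.z ⬝ᵥ r.x = r.z ⬝ᵥ p.x + 1 := by
    simp only [sympForm, vec] at h
    rw [dotProduct_comm r.z]
    generalize p.z ⬝ᵥ r.x = a at *
    generalize p.x ⬝ᵥ r.z = b at *
    revert a b; decide
  rw [neg_def, mul_def, mul_def, h]
  ext1
  · simp only [map_add, show doubling 1 = 2 from by decide]; ring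
  · exact add_comm _ _
  · exact add_comm _ _

theorem phase_sq (p : Pauli Q) : p * p = scalar (2 * p.phase + doubling (p.z ⬝ᵥ p.x)) := by
  rw [mul_def, scalar, two_mul]
  ext <;> simp [CharTwo.add_self_eq_zero]

theorem sq_eq_one_or (p : Pauli Q) : p * p = 1 ∨ p * p = -1 := by
  rw [phase_sq, neg_one_def, one_def, scalar]
  generalize p.phase = a
  generalize p.z ⬝ᵥ p.x = b
  simp only [Pauli.mk.injEq, and_true]
  revert a b; decide

theorem neg_mul (p r : Pauli Q) : -p * r = -(p * r) := by
  rw [neg_eq, neg_eq (p * r), mul_assoc]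

theorem mul_neg (p r : Pauli Q) : p * -r = -(p * r) := by
  rw [neg_eq, neg_eq (p * r), neg_one_def]
  change p * (scalar 2 * r) = scalar 2 * (p * r)
  rw [← mul_assoc, mul_scalar, mul_assoc]

theorem signed_mul_self {p : Pauli Q} (hp : p * p = 1) (m : ℤˣ) :
    p.signed m * p.signed m = 1 := by
  rcases signed_eq_or m p with h | h <;> rw [h]
  · exact hp
  · rw [neg_mul, mul_neg, Pauli.neg_neg, hp]

/-- Equal exponents leave a factor `i ^ c`, and comparing squares forces `2 * c = 0`. -/
theorem eq_or_eq_neg_of_vec_eq {p r : Pauli Q} (hp : p * p = 1) (hr : r * r = 1)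
    (h : p.vec = r.vec) : p = r ∨ p = -r := by
  obtain ⟨c, rfl⟩ := exists_scalar_mul_of_vec_eq h
  have : scalar c * r * (scalar c * r) = scalar (2 * c) := by
    rw [mul_assoc, ← mul_assoc r, mul_scalar, mul_assoc, hr, mul_one, scalar_mul]
    simp [scalar, two_mul]
  rw [this] at hp
  have hc : 2 * c = 0 := congrArg phase hp
  have : c = 0 ∨ c = 2 := by clear h this hp; revert c; decide
  rcases this with rfl | rfl
  · left; rw [scalar_mul]; simp
  · right; rw [scalar_mul, neg_def, add_comm]

end Pauli

/-! ## Stabilizer groups up to signs -/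

section Symp

variable {Q : Type} [Fintype Q]

/-- The image of a group of Paulis in the symplectic space. -/
def symp (S : Subgroup (Pauli Q)) : Submodule (ZMod 2) (SympSpace Q) where
  carrier := Pauli.vec '' S
  zero_mem' := ⟨1, S.one_mem, rfl⟩
  add_mem' := by
    rintro _ _ ⟨s, hs, rfl⟩ ⟨r, hr, rfl⟩
    exact ⟨s * r, S.mul_mem hs hr, rfl⟩
  smul_mem' := by
    rintro c _ ⟨s, hs, rfl⟩
    have : c = 0 ∨ c = 1 := by revert c; decide
    rcases this with rfl | rfl
    · exact ⟨1, S.one_mem, by simp⟩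
    · exact ⟨s, hs, by simp⟩

theorem mem_symp {S : Subgroup (Pauli Q)} {v : SympSpace Q} :
    v ∈ symp S ↔ ∃ s ∈ S, s.vec = v := Iff.rfl

theorem vec_mem_symp {S : Subgroup (Pauli Q)} {s : Pauli Q} (hs : s ∈ S) : s.vec ∈ symp S :=
  ⟨s, hs, rfl⟩

/-- The group of all Paulis with exponents in `L`. -/
def Pauli.ofSymp (L : Submodule (ZMod 2) (SympSpace Q)) : Subgroup (Pauli Q) where
  carrier := {p | p.vec ∈ L}
  one_mem' := L.zero_mem
  mul_mem' := L.add_mem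
  inv_mem' := id

/-- As a lower adjoint, `symp` commutes with suprema. Intersections need separate arguments, because
two groups may contain a Pauli with different signs. -/
theorem gc_symp : GaloisConnection (symp (Q := Q)) Pauli.ofSymp := by
  intro S L
  constructor
  · exact fun h s hs => h (vec_mem_symp hs)
  · rintro h _ ⟨s, hs, rfl⟩
    exact h hs

theorem symp_sup (S T : Subgroup (Pauli Q)) : symp (S ⊔ T) = symp S ⊔ symp T := gc_symp.l_sup

theorem symp_bot : symp (⊥ : Subgroup (Pauli Q)) = ⊥ := gc_symp.l_bot

theorem symp_closure (T : Set (Pauli Q)) :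
    symp (Subgroup.closure T) = Submodule.span (ZMod 2) (Pauli.vec '' T) := by
  apply le_antisymm
  · rw [gc_symp, Subgroup.closure_le]
    exact fun s hs => Submodule.subset_span ⟨s, hs, rfl⟩
  · rw [Submodule.span_le]
    rintro _ ⟨s, hs, rfl⟩
    exact vec_mem_symp (Subgroup.subset_closure hs)

/-- Here the intersection causes no trouble: commuting with `p` depends only on exponents, so any
preimage in `S` works. -/
theorem symp_inf_centralizer (S : Subgroup (Pauli Q)) (p : Pauli Q) :
    symp (S ⊓ Subgroup.centralizer {p}) =
      symp S ⊓ sympPerp (Submodule.span (ZMod 2) {p.vec}) := by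
  ext v
  simp only [Submodule.mem_inf, sympPerp_span, Set.mem_singleton_iff, forall_eq, mem_symp,
    Subgroup.mem_inf, Subgroup.mem_centralizer_singleton_iff]
  constructor
  · rintro ⟨s, ⟨hs, hc⟩, rfl⟩
    exact ⟨⟨s, hs, rfl⟩, (Pauli.commute_iff p s).1 hc.symm⟩
  · rintro ⟨⟨s, hs, rfl⟩, hc⟩
    exact ⟨s, ⟨hs, ((Pauli.commute_iff p s).2 hc).symm⟩, rfl⟩

namespace IsStabilizerGroup

variable {S : Subgroup (Pauli Q)}

theorem mono (hS : IsStabilizerGroup S) {T : Subgroup (Pauli Q)} (h : T ≤ S) :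
    IsStabilizerGroup T := fun h' => hS (h h')

theorem mul_self (hS : IsStabilizerGroup S) {s : Pauli Q} (hs : s ∈ S) : s * s = 1 :=
  (Pauli.sq_eq_one_or s).resolve_right fun h => hS (h ▸ S.mul_mem hs hs)

theorem neg_notMem (hS : IsStabilizerGroup S) {s : Pauli Q} (hs : s ∈ S) : -s ∉ S := by
  intro h
  apply hS
  have := S.mul_mem h hs
  rwa [Pauli.neg_mul, hS.mul_self hs] at this

/-- Anticommuting elements would put both `r * s` and its negative into `S`. -/
theorem commute (hS : IsStabilizerGroup S) {s r : Pauli Q} (hs : s ∈ S) (hr : r ∈ S) :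
    Commute s r := by
  by_contra h
  apply hS.neg_notMem (S.mul_mem hr hs)
  rw [← Pauli.mul_eq_neg_of_not_commute h]
  exact S.mul_mem hs hr

/-- This injectivity of `vec` on `S` is what allows signs to be ignored in all that follows. -/
theorem eq_of_vec_eq (hS : IsStabilizerGroup S) {s r : Pauli Q} (hs : s ∈ S) (hr : r ∈ S)
    (h : s.vec = r.vec) : s = r := by
  refine (Pauli.eq_or_eq_neg_of_vec_eq (hS.mul_self hs) (hS.mul_self hr) h).resolve_right ?_
  rintro rfl
  exact hS.neg_notMem hr hs

theorem symp_le_sympPerp (hS : IsStabilizerGroup S) : symp S ≤ sympPerp (symp S) := by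
  rintro _ ⟨s, hs, rfl⟩ _ ⟨r, hr, rfl⟩
  exact (Pauli.commute_iff r s).1 (hS.commute hr hs)

theorem mem_or_neg_mem (hS : IsStabilizerGroup S) {p : Pauli Q} (hp : p * p = 1)
    (h : p.vec ∈ symp S) : p ∈ S ∨ -p ∈ S := by
  obtain ⟨s, hs, hsp⟩ := h
  rcases Pauli.eq_or_eq_neg_of_vec_eq (hS.mul_self hs) hp hsp with rfl | rfl
  · exact Or.inl hs
  · exact Or.inr hs

theorem eq_of_symp_eq (hS : IsStabilizerGroup S) {T : Subgroup (Pauli Q)} (h : T ≤ S)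
    (h' : symp T = symp S) : T = S := by
  refine le_antisymm h fun s hs => ?_
  obtain ⟨t, ht, hts⟩ : s.vec ∈ symp T := h' ▸ vec_mem_symp hs
  rwa [← hS.eq_of_vec_eq (h ht) hs hts]

theorem bot : IsStabilizerGroup (⊥ : Subgroup (Pauli Q)) := by
  rw [IsStabilizerGroup, Subgroup.mem_bot, Pauli.neg_one_def, Pauli.one_def]
  simp only [Pauli.mk.injEq, and_true]
  decide

/-- A stabilizer group is generated by appropriate signs of Hermitian Paulis that generate it up to
signs. -/
theorem exists_eq_closure_signed (hS : IsStabilizerGroup S) {T : Set (Pauli Q)}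
    (hT : ∀ p ∈ T, p * p = 1) (h : symp S = Submodule.span (ZMod 2) (Pauli.vec '' T)) :
    ∃ ε : Pauli Q → ℤˣ, S = Subgroup.closure ((fun p => p.signed (ε p)) '' T) := by
  classical
  -- The sign is read off from membership: every `p ∈ T` has exponents in `symp S`, so `-p ∈ S`
  -- whenever `p ∉ S`.
  refine ⟨fun p => if p ∈ S then 1 else -1, (hS.eq_of_symp_eq ?_ ?_).symm⟩
  · rw [Subgroup.closure_le]
    rintro _ ⟨p, hp, rfl⟩
    have hpS : p.vec ∈ symp S := h ▸ Submodule.subset_span ⟨p, hp, rfl⟩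
    simp only [SetLike.mem_coe]
    split_ifs with hps
    · simpa [Pauli.signed] using hps
    · have := (hS.mem_or_neg_mem (hT p hp) hpS).resolve_left hps
      simpa [Pauli.signed, show ((-1 : ℤˣ) ≠ 1) from by decide] using this
  · rw [symp_closure, h, Set.image_image]
    simp

/-- Lifts of a basis of `symp S` generate `S`, and the image of any generating set spans `symp S`.
-/
theorem rank_eq_finrank (hS : IsStabilizerGroup S) :
    Group.rank S = Module.finrank (ZMod 2) (symp S) := by
  classical
  apply le_antisymm
  · let b := Module.finBasis (ZMod 2) (symp S)
    choose f hf hfv using fun i => mem_symp.1 (b i).2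
    have h : Subgroup.closure ((Finset.univ.image f : Finset (Pauli Q)) : Set (Pauli Q)) = S := by
      apply hS.eq_of_symp_eq
      · rw [Subgroup.closure_le]
        intro p hp
        obtain ⟨i, -, rfl⟩ := Finset.mem_image.1 (Finset.mem_coe.1 hp)
        exact hf i
      · rw [symp_closure]
        have : Pauli.vec '' ((Finset.univ.image f : Finset (Pauli Q)) : Set (Pauli Q)) =
            (symp S).subtype '' Set.range b := by
          ext v; simp [hfv]
        rw [this, Submodule.span_image, b.span_eq, Submodule.map_top, Submodule.range_subtype]
    rw [← Subgroup.rank_congr h]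
    refine (Subgroup.rank_closure_finset_le_card _).trans (Finset.card_image_le.trans ?_)
    simp
  · obtain ⟨T, hT, hT'⟩ := Group.rank_spec S
    rw [← hT]
    have h : Subgroup.closure ((T.image S.subtype : Finset (Pauli Q)) : Set (Pauli Q)) = S := by
      rw [Finset.coe_image, ← MonoidHom.map_closure, hT', ← MonoidHom.range_eq_map,
        Subgroup.range_subtype]
    have h' := symp_closure ((T.image S.subtype : Finset (Pauli Q)) : Set (Pauli Q))
    rw [h, ← Finset.coe_image] at h'
    rw [h']
    exact (finrank_span_finset_le_card _).trans
      (Finset.card_image_le.trans Finset.card_image_le)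

/-- Conjugation by a Pauli maps `s` to `s` or `-s`, and `-s ∉ S`; so normalizing `S` means commuting
with each of its elements. -/
theorem mem_normalizer (hS : IsStabilizerGroup S) {p : Pauli Q} :
    p ∈ Subgroup.normalizer (S : Set (Pauli Q)) ↔ p.vec ∈ sympPerp (symp S) := by
  constructor
  · rintro hp _ ⟨s, hs, rfl⟩
    rw [← Pauli.commute_iff]
    by_contra h
    have h1 := (Subgroup.mem_normalizer_iff.1 hp s).1 hs
    rw [Pauli.mul_eq_neg_of_not_commute fun h' => h h'.symm, Pauli.neg_mul,
      mul_inv_cancel_right] at h1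
    exact hS.neg_notMem hs h1
  · intro h
    have hc : ∀ s ∈ S, Commute p s := fun s hs =>
      ((Pauli.commute_iff s p).2 (h _ (vec_mem_symp hs))).symm
    rw [Subgroup.mem_normalizer_iff]
    intro s
    constructor
    · intro hs
      rwa [(hc s hs).eq, mul_inv_cancel_right]
    · intro hs
      have := hc _ hs
      have e : p * s * p⁻¹ = s := by
        have h2 : p * s * p⁻¹ * p = p * (p * s * p⁻¹) := this.eq.symm
        rw [inv_mul_cancel_right] at h2
        exact (mul_left_cancel h2).symm
      rwa [e] at hs

theorem mem_closure_imag_sup {p : Pauli Q} :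
    p ∈ Subgroup.closure {Pauli.imag} ⊔ S ↔ p.vec ∈ symp S := by
  constructor
  · intro h
    have := vec_mem_symp h
    rwa [symp_sup, symp_closure, Set.image_singleton,
      show (Pauli.imag : Pauli Q).vec = 0 from rfl, Submodule.span_zero_singleton,
      bot_sup_eq] at this
  · rintro ⟨s, hs, h⟩
    obtain ⟨c, rfl⟩ := Pauli.exists_scalar_mul_of_vec_eq h.symm
    refine mul_mem (Subgroup.mem_sup_left ?_) (Subgroup.mem_sup_right hs)
    have : ∀ n : ℕ, (Pauli.scalar n : Pauli Q) ∈ Subgroup.closure {Pauli.imag} := by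
      intro n
      induction n with
      | zero => exact one_mem _
      | succ n ih =>
        have e : (Pauli.scalar ((n + 1 : ℕ) : ZMod 4) : Pauli Q) =
            Pauli.scalar n * Pauli.imag := by
          rw [Pauli.scalar_mul]; simp [Pauli.scalar, Pauli.imag]
        rw [e]
        exact mul_mem ih (Subgroup.mem_closure_singleton_self _)
    simpa using this c.val

end IsStabilizerGroup

/-! ## Measurements up to signs -/

/-- Since `g` is an involution commuting with `T`, the union of `T` and its coset `g T` is already a
group. -/
theorem mem_or_mul_mem_of_mem_closure_sup {g : Pauli Q} (hg : g * g = 1)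
    {T : Subgroup (Pauli Q)} (hc : ∀ s ∈ T, Commute g s) {p : Pauli Q}
    (hp : p ∈ Subgroup.closure {g} ⊔ T) : p ∈ T ∨ g * p ∈ T := by
  let U : Subgroup (Pauli Q) :=
    { carrier := {p | p ∈ T ∨ g * p ∈ T}
      one_mem' := Or.inl T.one_mem
      mul_mem' := by
        rintro a b (ha | ha) (hb | hb)
        · exact Or.inl (T.mul_mem ha hb)
        · right
          rw [← mul_assoc, (hc a ha).eq, mul_assoc]
          exact T.mul_mem ha hb
        · right
          rw [← mul_assoc]
          exact T.mul_mem ha hb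
        · left
          have : a * b = g * a * (g * b) := by
            rw [← mul_assoc, ← (hc _ ha).eq, ← mul_assoc, hg, one_mul]
          rw [this]
          exact T.mul_mem ha hb
      inv_mem' := by
        rintro a (ha | ha)
        · exact Or.inl (T.inv_mem ha)
        · right
          have hg' : g⁻¹ = g := inv_eq_of_mul_eq_one_left hg
          have h := T.inv_mem ha
          have h2 := (hc _ h).eq
          rw [mul_inv_rev, hg'] at h2 h
          have h3 : g * a⁻¹ = a⁻¹ * g := by
            have h4 : g * a⁻¹ * g = a⁻¹ := by
              rw [mul_assoc, h2, mul_assoc, hg, mul_one]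
            calc g * a⁻¹ = g * a⁻¹ * (g * g) := by rw [hg, mul_one]
              _ = g * a⁻¹ * g * g := by rw [← mul_assoc]
              _ = a⁻¹ * g := by rw [h4]
          change g * a⁻¹ ∈ T
          rw [h3]
          exact h }
  have : Subgroup.closure {g} ⊔ T ≤ U := by
    rw [sup_le_iff, Subgroup.closure_le, Set.singleton_subset_iff]
    refine ⟨Or.inr ?_, fun s hs => Or.inl hs⟩
    rw [hg]
    exact T.one_mem
  exact this hp

/-- The three cases of a measurement have one common effect on exponents: a forced outcome means
that the span of `p` is already contained in `symp S`, and a commuting `p` means that the complement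
cuts nothing off. -/
theorem measurePauli_spec {S : Subgroup (Pauli Q)} (hS : IsStabilizerGroup S) {p : Pauli Q}
    (hp : p * p = 1) (m : ℤˣ) :
    IsStabilizerGroup (measurePauli S p m) ∧
    symp (measurePauli S p m) = Submodule.span (ZMod 2) {p.vec} ⊔
      (symp S ⊓ sympPerp (Submodule.span (ZMod 2) {p.vec})) := by
  have hg := Pauli.signed_mul_self hp m
  -- If adjoining `m p` to `T` produced `-1`, then `-1 ∈ T` or `-(m p) ∈ T`; the first is excluded
  -- by `T ≤ S`, the second by assumption.
  have key : ∀ T ≤ S, (∀ s ∈ T, Commute p s) → ¬ (p ∈ T ∨ -p ∈ T) →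
      IsStabilizerGroup (Subgroup.closure {p.signed m} ⊔ T) := by
    intro T hTS hc hn h
    have hc' : ∀ s ∈ T, Commute (p.signed m) s := by
      intro s hs
      rw [Pauli.commute_iff, Pauli.vec_signed, ← Pauli.commute_iff]
      exact hc s hs
    rcases mem_or_mul_mem_of_mem_closure_sup hg hc' h with h | h
    · exact hS (hTS h)
    · rw [Pauli.mul_neg, mul_one] at h
      apply hn
      rcases Pauli.signed_eq_or m p with e | e <;> rw [e] at h
      · exact Or.inr h
      · rw [Pauli.neg_neg] at h
        exact Or.inl h
  unfold measurePauli
  split_ifs with h1 h2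
  · refine ⟨hS, ?_⟩
    have hpS : p.vec ∈ symp S := by
      rcases h2 with h | h
      · exact vec_mem_symp h
      · simpa using vec_mem_symp h
    have hle : Submodule.span (ZMod 2) {p.vec} ≤ symp S := by
      rwa [Submodule.span_singleton_le_iff_mem]
    rw [inf_eq_left.2 (hS.symp_le_sympPerp.trans (sympPerp_anti hle)), sup_eq_right.2 hle]
  · refine ⟨key S le_rfl h1 h2, ?_⟩
    have : symp S ≤ sympPerp (Submodule.span (ZMod 2) {p.vec}) := by
      rintro _ ⟨s, hs, rfl⟩
      rw [sympPerp_span]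
      simpa using (Pauli.commute_iff p s).1 (h1 s hs)
    rw [inf_eq_left.2 this, symp_sup, symp_closure, Set.image_singleton, Pauli.vec_signed]
  · constructor
    -- If `p` or `-p` were in `S`, then `p` would commute with all of `S`, contrary to the case at
    -- hand.
    · refine key _ inf_le_left (fun s hs => ?_) fun h => h1 fun s hs => ?_
      · exact (Subgroup.mem_centralizer_singleton_iff.1 hs.2).symm
      · rcases h with h | h
        · exact hS.commute h.1 hs
        · have := hS.commute h.1 hs
          rwa [Pauli.commute_iff, Pauli.vec_neg, ← Pauli.commute_iff] at this
    · rw [symp_sup, symp_closure, Set.image_singleton, Pauli.vec_signed, symp_inf_centralizer]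

/-- Only the group generated by the list enters the formula, so the choice of generators, their
order and the outcomes do not matter up to signs. -/
theorem measureList_spec (l : List (Pauli Q)) (hl : ∀ p ∈ l, p * p = 1)
    (hc : ∀ p ∈ l, ∀ r ∈ l, Commute p r) {S : Subgroup (Pauli Q)} (hS : IsStabilizerGroup S)
    (m : ℕ → ℤˣ) :
    IsStabilizerGroup (measureList S l m) ∧
    symp (measureList S l m) = symp (Subgroup.closure {p | p ∈ l}) ⊔
      (symp S ⊓ sympPerp (symp (Subgroup.closure {p | p ∈ l}))) := by
  induction l generalizing S m with
  | nil =>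
    refine ⟨hS, ?_⟩
    have : sympPerp (⊥ : Submodule (ZMod 2) (SympSpace Q)) = ⊤ := by
      ext v; simp [mem_sympPerp, sympForm]
    simp [measureList, symp_bot, this]
  | cons p l ih =>
    obtain ⟨h1, h2⟩ := measurePauli_spec hS (hl p (by simp)) (m 0)
    obtain ⟨h3, h4⟩ := ih (fun p hp => hl p (by simp [hp]))
      (fun p hp r hr => hc p (by simp [hp]) r (by simp [hr])) h1 fun j => m (j + 1)
    refine ⟨h3, ?_⟩
    have e : {r | r ∈ p :: l} = {p} ∪ {r | r ∈ l} := by ext; simp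
    rw [measureList, h4, h2, e, Subgroup.closure_union, symp_sup, sympPerp_sup, symp_closure {p},
      Set.image_singleton]
    set N := symp (Subgroup.closure {r | r ∈ l})
    set P := Submodule.span (ZMod 2) {p.vec}
    have hPN : P ≤ sympPerp N := by
      rw [Submodule.span_singleton_le_iff_mem]
      change p.vec ∈ sympPerp (symp _)
      rw [symp_closure, sympPerp_span]
      rintro _ ⟨r, hr, rfl⟩
      exact (Pauli.commute_iff r p).1 (hc r (List.mem_cons_of_mem _ hr) p (by simp))
    -- The modular law: `P ≤ sympPerp N`, so `P` can be pulled out of the intersection with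
    -- `sympPerp N`.
    rw [sup_inf_assoc_of_le _ hPN, inf_assoc, ← sup_assoc, sup_comm N P]

end Symp

/-! ## Stabilizer groups of CSS type -/

section CSS

variable {Q : Type} [Fintype Q]

/-- The orthogonal complement for the dot product. -/
def dotPerp (A : Submodule (ZMod 2) (Q → ZMod 2)) : Submodule (ZMod 2) (Q → ZMod 2) where
  carrier := {v | ∀ u ∈ A, u ⬝ᵥ v = 0}
  zero_mem' := by simp
  add_mem' ha hb u hu := by rw [dotProduct_add, ha u hu, hb u hu, add_zero]
  smul_mem' c v hv u hu := by rw [dotProduct_smul, hv u hu, smul_zero]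

theorem mem_dotPerp {A : Submodule (ZMod 2) (Q → ZMod 2)} {v : Q → ZMod 2} :
    v ∈ dotPerp A ↔ ∀ u ∈ A, u ⬝ᵥ v = 0 := Iff.rfl

theorem mem_dotPerp_span {T : Set (Q → ZMod 2)} {v : Q → ZMod 2} :
    v ∈ dotPerp (Submodule.span (ZMod 2) T) ↔ ∀ u ∈ T, u ⬝ᵥ v = 0 := by
  constructor
  · exact fun h u hu => h u (Submodule.subset_span hu)
  · intro h u hu
    induction hu using Submodule.span_induction with
    | mem u hu => exact h u hu
    | zero => simp
    | add a b _ _ ha hb => rw [add_dotProduct, ha, hb, add_zero]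
    | smul c a _ ha => rw [smul_dotProduct, ha, smul_zero]

theorem dotPerp_bot : dotPerp (⊥ : Submodule (ZMod 2) (Q → ZMod 2)) = ⊤ := by
  ext v; simp [mem_dotPerp]

/-- The form pairs `X`-exponents only with `Z`-exponents, hence the exchange of the factors. -/
theorem sympPerp_prod (A B : Submodule (ZMod 2) (Q → ZMod 2)) :
    sympPerp (A.prod B) = (dotPerp B).prod (dotPerp A) := by
  ext ⟨x, z⟩
  simp only [mem_sympPerp, sympForm, Submodule.mem_prod, mem_dotPerp, Prod.forall, and_imp]
  constructor
  · intro h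
    exact ⟨fun u hu => by simpa using h 0 u A.zero_mem hu,
      fun u hu => by simpa using h u 0 hu B.zero_mem⟩
  · rintro ⟨h, h'⟩ a b ha hb
    rw [h b hb, h' a ha, add_zero]

/-! ### Logical qubits from dual bases -/

/-- Representatives of the Pauli operators of `k` logical qubits of a stabilizer group with the
`X`-type part `A` and the `Z`-type part `B`. -/
structure LogicalBasis (A B : Submodule (ZMod 2) (Q → ZMod 2)) (k : ℕ) where
  a : Fin k → Q → ZMod 2
  b : Fin k → Q → ZMod 2
  dual : ∀ i j, a i ⬝ᵥ b j = if i = j then 1 else 0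
  a_mem : ∀ i, a i ∈ dotPerp B
  b_mem : ∀ i, b i ∈ dotPerp A
  le_a : dotPerp B ≤ A ⊔ Submodule.span (ZMod 2) (Set.range a)
  le_b : dotPerp A ≤ B ⊔ Submodule.span (ZMod 2) (Set.range b)

/-- A family and a dual family of the same size as the space yield an expansion of vectors. -/
theorem sum_dotProduct_smul_of_dual {ι : Type} [Fintype ι] [DecidableEq ι]
    (hι : Fintype.card ι = Fintype.card Q) {a b : ι → Q → ZMod 2}
    (h : ∀ i j, a i ⬝ᵥ b j = if i = j then 1 else 0) (v : Q → ZMod 2) :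
    ∑ i, (b i ⬝ᵥ v) • a i = v := by
  classical
  have h1 : Matrix.of a * (Matrix.of b)ᵀ = 1 := by
    ext i j
    rw [Matrix.one_apply, ← h i j]
    rfl
  have h2 := (Matrix.mul_eq_one_comm_of_card_eq _ _ _ hι).1 h1
  have h3 := congrArg (fun M => v ᵥ* M) h2
  simp only [Matrix.vecMul_one, ← Matrix.vecMul_vecMul] at h3
  conv_rhs => rw [← h3]
  ext q
  rw [Finset.sum_apply]
  refine Finset.sum_congr rfl fun i _ => ?_
  rw [Pi.smul_apply, smul_eq_mul, dotProduct_comm]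
  rfl

theorem linearIndependent_of_dual {ι : Type} [Fintype ι] [DecidableEq ι]
    {a b : ι → Q → ZMod 2} (h : ∀ i j, a i ⬝ᵥ b j = if i = j then 1 else 0) :
    LinearIndependent (ZMod 2) a := by
  rw [Fintype.linearIndependent_iff]
  intro g hg i
  have := congrArg (fun v => v ⬝ᵥ b i) hg
  simpa [sum_dotProduct, h] using this

namespace LogicalBasis

variable {A B : Submodule (ZMod 2) (Q → ZMod 2)} {k : ℕ}

/-- Exchanging `X` and `Z`. -/
def swap (Λ : LogicalBasis A B k) : LogicalBasis B A k where
  a := Λ.b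
  b := Λ.a
  dual i j := by rw [dotProduct_comm, Λ.dual]; simp only [eq_comm]
  a_mem := Λ.b_mem
  b_mem := Λ.a_mem
  le_a := Λ.le_b
  le_b := Λ.le_a

/-- A basis that consists of stabilizers, logical operators, and others, together with the dual
basis. -/
def ofDual {r s : ℕ} {a b : Fin r ⊕ Fin k ⊕ Fin s → Q → ZMod 2}
    (hQ : r + (k + s) = Fintype.card Q) (h : ∀ i j, a i ⬝ᵥ b j = if i = j then 1 else 0)
    (hA : A = Submodule.span (ZMod 2) (Set.range fun i => a (.inl i)))
    (hB : B = Submodule.span (ZMod 2) (Set.range fun i => b (.inr (.inr i)))) :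
    LogicalBasis A B k where
  a i := a (.inr (.inl i))
  b i := b (.inr (.inl i))
  dual i j := by rw [h]; simp
  a_mem i := by
    rw [hB, mem_dotPerp_span]
    rintro _ ⟨j, rfl⟩
    rw [dotProduct_comm, h]; simp
  b_mem i := by
    rw [hA, mem_dotPerp_span]
    rintro _ ⟨j, rfl⟩
    rw [h]; simp
  le_a v hv := by
    -- By duality `b i ⬝ᵥ v` is the coefficient of `v` at `a i`; orthogonality to `B` kills the
    -- coefficients of the last `s` vectors.
    have hs : ∀ j, b (.inr (.inr j)) ⬝ᵥ v = 0 := fun j => hv _ (by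
      rw [hB]; exact Submodule.subset_span ⟨j, rfl⟩)
    have := sum_dotProduct_smul_of_dual (by simpa using hQ) h v
    simp only [Fintype.sum_sum_type, hs, zero_smul, Finset.sum_const_zero, add_zero] at this
    rw [← this, hA]
    exact Submodule.add_mem_sup
      (Submodule.sum_mem _ fun i _ => Submodule.smul_mem _ _ (Submodule.subset_span ⟨i, rfl⟩))
      (Submodule.sum_mem _ fun i _ => Submodule.smul_mem _ _ (Submodule.subset_span ⟨i, rfl⟩))
  le_b v hv := by
    have hs : ∀ j, a (.inl j) ⬝ᵥ v = 0 := fun j => hv _ (by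
      rw [hA]; exact Submodule.subset_span ⟨j, rfl⟩)
    have h' : ∀ i j, b i ⬝ᵥ a j = if i = j then 1 else 0 := fun i j => by
      rw [dotProduct_comm, h]; simp only [eq_comm]
    have := sum_dotProduct_smul_of_dual (by simpa using hQ) h' v
    simp only [Fintype.sum_sum_type, hs, zero_smul, Finset.sum_const_zero, zero_add] at this
    rw [← this, hB, add_comm]
    exact Submodule.add_mem_sup
      (Submodule.sum_mem _ fun i _ => Submodule.smul_mem _ _ (Submodule.subset_span ⟨i, rfl⟩))
      (Submodule.sum_mem _ fun i _ => Submodule.smul_mem _ _ (Submodule.subset_span ⟨i, rfl⟩))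

/-- The embedding of the Pauli group of the logical qubits. -/
def embed (Λ : LogicalBasis A B k) : Pauli (Fin k) →* Pauli Q :=
  MonoidHom.mk'
    (fun p => ⟨p.phase, Fintype.linearCombination (ZMod 2) Λ.a p.x,
      Fintype.linearCombination (ZMod 2) Λ.b p.z⟩) fun p r => by
    -- Dual families preserve the pairing of `z` with `x`, which is the only source of phases in a
    -- product.
    have : Fintype.linearCombination (ZMod 2) Λ.b p.z ⬝ᵥ
        Fintype.linearCombination (ZMod 2) Λ.a r.x = p.z ⬝ᵥ r.x := by
      rw [dotProduct_comm p.z, dotProduct_comm]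
      simp only [Fintype.linearCombination_apply, sum_dotProduct, dotProduct_sum,
        smul_dotProduct, dotProduct_smul, Λ.dual, smul_eq_mul, mul_ite, mul_one, mul_zero,
        Finset.sum_ite_eq', Finset.mem_univ, if_true]
      exact dotProduct_comm _ _
    simp only [Pauli.mul_def, this, map_add]

theorem embed_mem_sympPerp (Λ : LogicalBasis A B k) (p : Pauli (Fin k)) :
    (Λ.embed p).vec ∈ sympPerp (A.prod B) := by
  rw [sympPerp_prod]
  have hx : ∑ i, p.x i • Λ.a i ∈ dotPerp B :=
    Submodule.sum_mem _ fun i _ => Submodule.smul_mem _ _ (Λ.a_mem i)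
  have hz : ∑ i, p.z i • Λ.b i ∈ dotPerp A :=
    Submodule.sum_mem _ fun i _ => Submodule.smul_mem _ _ (Λ.b_mem i)
  exact ⟨hx, hz⟩

/-- Pairing with the dual logical operators recovers the exponents of `p`, and these operators
annihilate the stabilizers. -/
theorem eq_scalar_of_embed_vec_mem (Λ : LogicalBasis A B k) {p : Pauli (Fin k)}
    (h : (Λ.embed p).vec ∈ A.prod B) : p = Pauli.scalar p.phase := by
  ext i
  · rfl
  · have := Λ.b_mem i _ h.1
    change Fintype.linearCombination (ZMod 2) Λ.a p.x ⬝ᵥ Λ.b i = 0 at this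
    simpa [Fintype.linearCombination_apply, sum_dotProduct, Λ.dual, Pauli.scalar] using this
  · have := Λ.a_mem i _ h.2
    change Fintype.linearCombination (ZMod 2) Λ.b p.z ⬝ᵥ Λ.a i = 0 at this
    rw [dotProduct_comm] at this
    simpa [Fintype.linearCombination_apply, dotProduct_sum, Λ.dual, Pauli.scalar] using this

theorem exists_embed_vec (Λ : LogicalBasis A B k) {v : SympSpace Q}
    (hv : v ∈ sympPerp (A.prod B)) : ∃ p, ∃ w ∈ A.prod B, v = (Λ.embed p).vec + w := by
  rw [sympPerp_prod] at hv
  obtain ⟨u, hu, x, hx, hux⟩ := Submodule.mem_sup.1 (Λ.le_a hv.1)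
  obtain ⟨u', hu', z, hz, huz⟩ := Submodule.mem_sup.1 (Λ.le_b hv.2)
  rw [← Fintype.range_linearCombination] at hx hz
  obtain ⟨x, rfl⟩ := hx
  obtain ⟨z, rfl⟩ := hz
  refine ⟨⟨0, x, z⟩, (u, u'), ⟨hu, hu'⟩, ?_⟩
  rw [add_comm]
  exact Prod.ext hux.symm huz.symm

/-- Embed the logical Paulis into the normalizer and pass to the quotient. An element of the kernel
is a scalar lying in `S`, hence `1`. Each normalizer element is an embedded Pauli times a stabilizer
up to a scalar, and scalars are embedded too. -/
theorem nonempty_mulEquiv (Λ : LogicalBasis A B k) {S : Subgroup (Pauli Q)}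
    (hS : IsStabilizerGroup S) (h : symp S = A.prod B) :
    Nonempty (LogicalPauliGroup S ≃* Pauli (Fin k)) := by
  have hN : ∀ p, Λ.embed p ∈ Subgroup.normalizer (S : Set (Pauli Q)) := fun p => by
    rw [hS.mem_normalizer, h]
    exact Λ.embed_mem_sympPerp p
  let f : Pauli (Fin k) →* LogicalPauliGroup S :=
    (QuotientGroup.mk' (S.subgroupOf (Subgroup.normalizer (S : Set (Pauli Q))))).comp
      (Λ.embed.codRestrict _ hN)
  refine ⟨(MulEquiv.ofBijective f ⟨?_, ?_⟩).symm⟩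
  · rw [injective_iff_map_eq_one]
    intro p hp
    have hp : Λ.embed p ∈ S := by
      simpa [f, QuotientGroup.eq_one_iff, Subgroup.mem_subgroupOf] using hp
    have h0 := Λ.eq_scalar_of_embed_vec_mem (h ▸ vec_mem_symp hp)
    have h1 : (Λ.embed p).vec = (1 : Pauli Q).vec := by
      rw [h0]
      change (Fintype.linearCombination (ZMod 2) Λ.a 0,
        Fintype.linearCombination (ZMod 2) Λ.b 0) = 0
      simp
    have h2 := hS.eq_of_vec_eq hp S.one_mem h1
    have h3 : p.phase = 0 := congrArg Pauli.phase h2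
    rw [h0, h3]
    rfl
  · intro g
    obtain ⟨⟨p, hp⟩, rfl⟩ := QuotientGroup.mk_surjective g
    obtain ⟨l, w, hw, hpl⟩ := Λ.exists_embed_vec (h ▸ hS.mem_normalizer.1 hp)
    rw [← h] at hw
    obtain ⟨s, hs, rfl⟩ := hw
    obtain ⟨c, hc⟩ := Pauli.exists_scalar_mul_of_vec_eq (hpl.trans (Pauli.vec_mul _ _).symm)
    refine ⟨Pauli.scalar c * l, ?_⟩
    change QuotientGroup.mk _ = QuotientGroup.mk _
    rw [QuotientGroup.eq, Subgroup.mem_subgroupOf]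
    have e : Λ.embed (Pauli.scalar c) = Pauli.scalar c := by
      change (⟨c, Fintype.linearCombination (ZMod 2) Λ.a 0,
        Fintype.linearCombination (ZMod 2) Λ.b 0⟩ : Pauli Q) = _
      simp [Pauli.scalar]
    change (Λ.embed (Pauli.scalar c * l))⁻¹ * p ∈ S
    rw [map_mul, e, hc, ← mul_assoc (Pauli.scalar c), inv_mul_cancel_left]
    exact hs

end LogicalBasis

/-! ### Rank and distance from the two binary codes -/

theorem rank_eq_of_symp_eq_prod {A B : Submodule (ZMod 2) (Q → ZMod 2)} {S : Subgroup (Pauli Q)}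
    (hS : IsStabilizerGroup S) (h : symp S = A.prod B) :
    Group.rank S = Module.finrank (ZMod 2) A + Module.finrank (ZMod 2) B := by
  rw [hS.rank_eq_finrank, h, ← Module.finrank_prod]
  exact LinearEquiv.finrank_eq
    { toFun := fun v => (⟨v.1.1, v.2.1⟩, ⟨v.1.2, v.2.2⟩)
      invFun := fun v => ⟨(v.1.1, v.2.1), v.1.2, v.2.2⟩
      map_add' := fun _ _ => rfl
      map_smul' := fun _ _ => rfl }

theorem eq_zero_or_eq_single {Q : Type} [DecidableEq Q] {v : Q → ZMod 2} {q : Q}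
    (h : ∀ r, v r ≠ 0 → r = q) :
    v = 0 ∨ v = Pi.single q 1 := by
  have hr : ∀ r, r ≠ q → v r = 0 := fun r hr => by_contra fun h' => hr (h r h')
  have hq : ∀ c : ZMod 2, c = 0 ∨ c = 1 := by decide
  rcases hq (v q) with hq | hq
  · left
    ext r
    by_cases e : r = q
    · rw [e, hq]; rfl
    · exact hr r e
  · right
    ext r
    by_cases e : r = q
    · rw [e, hq, Pi.single_eq_same]
    · rw [hr r e, Pi.single_eq_of_ne e]

/-- If the weight is at most one, the `X`-part and the `Z`-part are each zero or the indicator of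
one common qubit, so it suffices to test such indicators. -/
theorem two_le_weight [DecidableEq Q] {A B : Submodule (ZMod 2) (Q → ZMod 2)} {S : Subgroup (Pauli Q)}
    (hS : IsStabilizerGroup S) (h : symp S = A.prod B)
    (hA : ∀ q, (Pi.single q 1 : Q → ZMod 2) ∈ dotPerp B → (Pi.single q 1 : Q → ZMod 2) ∈ A)
    (hB : ∀ q, (Pi.single q 1 : Q → ZMod 2) ∈ dotPerp A → (Pi.single q 1 : Q → ZMod 2) ∈ B)
    {p : Pauli Q} (hp : p ∈ nontrivialLogicals S) : 2 ≤ p.weight := by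
  obtain ⟨hN, hn⟩ := hp
  rw [IsStabilizerGroup.mem_closure_imag_sup, h] at hn
  rw [hS.mem_normalizer, h, sympPerp_prod] at hN
  obtain ⟨hx, hz⟩ := hN
  change p.x ∈ dotPerp B at hx
  change p.z ∈ dotPerp A at hz
  by_contra hw
  have hw : p.weight ≤ 1 := by omega
  apply hn
  unfold Pauli.weight at hw
  rw [Finset.card_le_one] at hw
  simp only [Finset.mem_filter, Finset.mem_univ, true_and] at hw
  by_cases he : ∃ q, p.x q ≠ 0 ∨ p.z q ≠ 0
  · obtain ⟨q, hq⟩ := he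
    constructor
    · change p.x ∈ A
      rcases eq_zero_or_eq_single fun r hr => hw r (Or.inl hr) q hq with e | e
      · rw [e]; exact A.zero_mem
      · rw [e] at hx ⊢; exact hA q hx
    · change p.z ∈ B
      rcases eq_zero_or_eq_single fun r hr => hw r (Or.inr hr) q hq with e | e
      · rw [e]; exact B.zero_mem
      · rw [e] at hz ⊢; exact hB q hz
  · push Not at he
    have : p.vec = 0 := Prod.ext (funext fun q => (he q).1) (funext fun q => (he q).2)
    rw [this]
    exact Submodule.zero_mem _

/-- The vector `Λ.a i` pairs to `1` with `Λ.b i`, which is orthogonal to `A`; so it cannot lie in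
`A`. -/
theorem LogicalBasis.exists_nontrivialLogical {A B : Submodule (ZMod 2) (Q → ZMod 2)} {k : ℕ}
    (Λ : LogicalBasis A B k) {S : Subgroup (Pauli Q)} (hS : IsStabilizerGroup S)
    (h : symp S = A.prod B) (i : Fin k) :
    ∃ p ∈ nontrivialLogicals S, p.weight = (Finset.univ.filter fun q => Λ.a i q ≠ 0).card := by
  refine ⟨⟨0, Λ.a i, 0⟩, ⟨?_, fun hn => ?_⟩, ?_⟩
  · rw [hS.mem_normalizer, h, sympPerp_prod]
    exact ⟨Λ.a_mem i, Submodule.zero_mem _⟩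
  · rw [IsStabilizerGroup.mem_closure_imag_sup, h] at hn
    have := Λ.b_mem i _ hn.1
    change Λ.a i ⬝ᵥ Λ.b i = 0 at this
    rw [Λ.dual] at this
    simp at this
  · simp [Pauli.weight]

theorem LogicalBasis.exists_nontrivialLogical' {A B : Submodule (ZMod 2) (Q → ZMod 2)} {k : ℕ}
    (Λ : LogicalBasis A B k) {S : Subgroup (Pauli Q)} (hS : IsStabilizerGroup S)
    (h : symp S = A.prod B) (i : Fin k) :
    ∃ p ∈ nontrivialLogicals S, p.weight = (Finset.univ.filter fun q => Λ.b i q ≠ 0).card := by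
  refine ⟨⟨0, 0, Λ.b i⟩, ⟨?_, fun hn => ?_⟩, ?_⟩
  · rw [hS.mem_normalizer, h, sympPerp_prod]
    exact ⟨Submodule.zero_mem _, Λ.b_mem i⟩
  · rw [IsStabilizerGroup.mem_closure_imag_sup, h] at hn
    have := Λ.a_mem i _ hn.2
    change Λ.b i ⬝ᵥ Λ.a i = 0 at this
    rw [dotProduct_comm, Λ.dual] at this
    simp at this
  · simp [Pauli.weight]

/-! ## Schedules of alternating type -/

/-- The space of the Paulis whose part of basis `b` is in `A` and whose part of the opposite basis
is in `B`. -/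
def Basis.prod (b : Basis) (A B : Submodule (ZMod 2) (Q → ZMod 2)) :
    Submodule (ZMod 2) (SympSpace Q) :=
  match b with
  | .X => A.prod B
  | .Z => B.prod A

theorem Basis.prod_flip {Q : Type} (b : Basis) (A B : Submodule (ZMod 2) (Q → ZMod 2)) :
    b.flip.prod A B = b.prod B A := by cases b <;> rfl

theorem Basis.prod_sup_prod {Q : Type} (b : Basis) (A B A' B' : Submodule (ZMod 2) (Q → ZMod 2)) :
    b.prod A B ⊔ b.prod A' B' = b.prod (A ⊔ A') (B ⊔ B') := by
  cases b <;> exact Submodule.prod_sup_prod ..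

theorem Basis.prod_inf_prod {Q : Type} (b : Basis) (A B A' B' : Submodule (ZMod 2) (Q → ZMod 2)) :
    b.prod A B ⊓ b.prod A' B' = b.prod (A ⊓ A') (B ⊓ B') := by
  cases b <;> exact Submodule.prod_inf_prod ..

theorem Basis.sympPerp_prod (b : Basis) (A B : Submodule (ZMod 2) (Q → ZMod 2)) :
    sympPerp (b.prod A B) = b.prod (dotPerp B) (dotPerp A) := by
  cases b <;> exact _root_.sympPerp_prod ..

open Classical in
/-- The characteristic vector of a set of qubits. -/
noncomputable def charVec (S : Finset Q) : Q → ZMod 2 := fun q => if q ∈ S then 1 else 0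

theorem charVec_apply {Q : Type} [DecidableEq Q] (S : Finset Q) (q : Q) :
    charVec S q = if q ∈ S then 1 else 0 := by
  unfold charVec; split_ifs <;> rfl

theorem Basis.span_vec_pauli {Q : Type} (b : Basis) (T : Set (Finset Q)) :
    Submodule.span (ZMod 2) (Pauli.vec '' (b.pauli '' T)) =
      b.prod (Submodule.span (ZMod 2) (charVec '' T)) ⊥ := by
  cases b
  · change _ = Submodule.prod _ _
    rw [← Submodule.map_inl, ← Submodule.span_image, Set.image_image, Set.image_image]
    rfl
  · change _ = Submodule.prod _ _
    rw [← Submodule.map_inr, ← Submodule.span_image, Set.image_image, Set.image_image]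
    rfl

/-- The group of the products of `X`s, or of the products of `Z`s. -/
def Basis.group (b : Basis) : Subgroup (Pauli Q) where
  carrier := {p | p.phase = 0 ∧ match b with | .X => p.z = 0 | .Z => p.x = 0}
  one_mem' := by cases b <;> exact ⟨rfl, rfl⟩
  mul_mem' := by
    rintro ⟨c, x, z⟩ ⟨c', x', z'⟩ ⟨rfl, h⟩ ⟨rfl, h'⟩
    cases b <;> simp_all [Pauli.mul_def]
  inv_mem' := by
    rintro ⟨c, x, z⟩ ⟨rfl, h⟩
    have : (⟨0, x, z⟩ : Pauli Q)⁻¹ = ⟨0, x, z⟩ := by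
      rw [inv_eq_iff_mul_eq_one, Pauli.phase_sq]
      cases b <;> simp_all <;> rfl
    rw [this]
    exact ⟨rfl, h⟩

theorem Basis.mul_self_of_mem_group {b : Basis} {p : Pauli Q} (hp : p ∈ b.group) : p * p = 1 := by
  obtain ⟨c, x, z⟩ := p
  obtain ⟨rfl, h⟩ := hp
  rw [Pauli.phase_sq]
  cases b <;> simp_all <;> rfl

theorem Basis.commute_of_mem_group {b : Basis} {p r : Pauli Q} (hp : p ∈ b.group)
    (hr : r ∈ b.group) : Commute p r := by
  obtain ⟨c, x, z⟩ := p
  obtain ⟨rfl, h⟩ := hp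
  obtain ⟨c', x', z'⟩ := r
  obtain ⟨rfl, h'⟩ := hr
  rw [Pauli.commute_iff]
  cases b <;> simp_all [sympForm, Pauli.vec]

theorem Basis.isStabilizerGroup_group (b : Basis) : IsStabilizerGroup (b.group (Q := Q)) := by
  rintro ⟨h, -⟩
  rw [Pauli.neg_one_def] at h
  exact absurd h (by decide : (2 : ZMod 4) ≠ 0)

theorem Basis.pauli_mem_group (b : Basis) (S : Finset Q) : b.pauli S ∈ b.group := by
  cases b <;> exact ⟨rfl, rfl⟩

theorem Basis.pauli_mul_self (b : Basis) (S : Finset Q) : b.pauli S * b.pauli S = 1 :=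
  Basis.mul_self_of_mem_group (b.pauli_mem_group S)

open Classical in
theorem Basis.weight_pauli (b : Basis) (S : Finset Q) : (b.pauli S).weight = S.card := by
  cases b <;> simp [Pauli.weight, Basis.pauli]

variable {ℓ : ℕ} (R : ZMod ℓ → CSSRound Q)

theorem CSSRound.paulis_eq {Q : Type} (R : CSSRound Q) : R.paulis = R.basis.pauli '' R.supports := by
  ext p; simp [CSSRound.paulis, eq_comm]

/-- The span of the characteristic vectors of the measurements. -/
noncomputable def CSSRound.span (R : CSSRound Q) : Submodule (ZMod 2) (Q → ZMod 2) :=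
  Submodule.span (ZMod 2) (charVec '' (R.supports : Set (Finset Q)))

/-- A run may measure any generating set of the round. This bound guarantees that all its elements
commute and square to `1`. -/
theorem CSSRound.closure_paulis_le (R : CSSRound Q) :
    Subgroup.closure R.paulis ≤ R.basis.group := by
  rw [Subgroup.closure_le, R.paulis_eq]
  rintro _ ⟨S, -, rfl⟩
  exact R.basis.pauli_mem_group S

theorem CSSRound.symp_closure_paulis (R : CSSRound Q) :
    symp (Subgroup.closure R.paulis) = R.basis.prod R.span ⊥ := by
  rw [symp_closure, R.paulis_eq, Basis.span_vec_pauli]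
  rfl

theorem isStabilizerGroup_cssSchedule (t : ℕ) : IsStabilizerGroup (cssSchedule R t) :=
  (R t).basis.isStabilizerGroup_group.mono (R t).closure_paulis_le

/-- The parts of the instantaneous stabilizer group after `j + 1` timesteps in the basis of the last
timestep and in the opposite basis, up to signs. -/
noncomputable def cssParts : ℕ →
    Submodule (ZMod 2) (Q → ZMod 2) × Submodule (ZMod 2) (Q → ZMod 2)
  | 0 => ((R 0).span, ⊥)
  | j + 1 => ((R (j + 1 : ℕ)).span ⊔ (cssParts j).2,
      (cssParts j).1 ⊓ dotPerp (R (j + 1 : ℕ)).span)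

variable {R}

/-- The factor `⊤` appears because stabilizers in the measured basis always commute with the round;
only the opposite part gets cut. -/
theorem Run.after_succ_spec (ρ : Run (cssSchedule R)) {j : ℕ}
    (h : IsStabilizerGroup (ρ.after j)) :
    IsStabilizerGroup (ρ.after (j + 1)) ∧
    symp (ρ.after (j + 1)) = (R j).basis.prod (R j).span ⊥ ⊔
      (symp (ρ.after j) ⊓ (R j).basis.prod ⊤ (dotPerp (R j).span)) := by
  have hle : ∀ p ∈ ρ.gens j, p ∈ (R j).basis.group := fun p hp =>
    (R j).closure_paulis_le
      ((ρ.closure_gens j).le (Subgroup.subset_closure (show p ∈ {p | p ∈ ρ.gens j} from hp)))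
  have := measureList_spec (ρ.gens j) (fun p hp => Basis.mul_self_of_mem_group (hle p hp))
    (fun p hp r hr => Basis.commute_of_mem_group (hle p hp) (hle r hr)) h (ρ.outcome j)
  rwa [ρ.closure_gens, cssSchedule, CSSRound.symp_closure_paulis, Basis.sympPerp_prod,
    dotPerp_bot] at this

theorem Run.after_spec (hR : ∀ t, (R (t + 1)).basis = (R t).basis.flip)
    (ρ : Run (cssSchedule R)) (j : ℕ) :
    IsStabilizerGroup (ρ.after (j + 1)) ∧
    symp (ρ.after (j + 1)) = (R j).basis.prod (cssParts R j).1 (cssParts R j).2 := by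
  induction j with
  | zero =>
    obtain ⟨h1, h2⟩ := ρ.after_succ_spec (j := 0) IsStabilizerGroup.bot
    refine ⟨h1, ?_⟩
    rw [h2]
    change _ ⊔ (symp ⊥ ⊓ _) = _
    rw [symp_bot, bot_inf_eq, sup_bot_eq]
    simp [cssParts]
  | succ j ih =>
    obtain ⟨h1, h2⟩ := ρ.after_succ_spec ih.1
    refine ⟨h1, ?_⟩
    -- The next round measures in the other basis, so the two parts change roles.
    have hf : (R j).basis.prod (cssParts R j).1 (cssParts R j).2 =
        (R (j + 1 : ℕ)).basis.prod (cssParts R j).2 (cssParts R j).1 := by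
      rw [Nat.cast_succ, hR, Basis.prod_flip]
    rw [h2, ih.2, hf, Basis.prod_inf_prod, Basis.prod_sup_prod, inf_top_eq, bot_sup_eq]
    rfl

theorem Run.exists_isg_eq_after {M : ℕ → Subgroup (Pauli Q)} (ρ : Run M) {T : ℕ} {t : ℤ}
    (ht : T ≤ t) : ∃ j : ℕ, T ≤ j ∧ t = j ∧ ρ.isg t = ρ.after (j + 1) := by
  obtain ⟨j, rfl⟩ := Int.eq_ofNat_of_zero_le (by omega : 0 ≤ t)
  exact ⟨j, by omega, rfl, rfl⟩

/-- A criterion for a CSS schedule with alternating bases to have distance two. -/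
theorem isISGCode_two [DecidableEq Q] (hR : ∀ t, (R (t + 1)).basis = (R t).basis.flip) {T n k : ℕ}
    (hn : Fintype.card Q = n)
    (hΛ : ∀ j, T ≤ j → ∃ Λ : LogicalBasis (cssParts R j).1 (cssParts R j).2 k,
      ∃ i, (Finset.univ.filter fun q => Λ.a i q ≠ 0).card = 2)
    (hrank : ∀ j, T ≤ j → Module.finrank (ZMod 2) (cssParts R j).1 +
      Module.finrank (ZMod 2) (cssParts R j).2 + k = n)
    (h₁ : ∀ j, T ≤ j → ∀ q, (Pi.single q 1 : Q → ZMod 2) ∈ dotPerp (cssParts R j).2 →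
      (Pi.single q 1 : Q → ZMod 2) ∈ (cssParts R j).1)
    (h₂ : ∀ j, T ≤ j → ∀ q, (Pi.single q 1 : Q → ZMod 2) ∈ dotPerp (cssParts R j).1 →
      (Pi.single q 1 : Q → ZMod 2) ∈ (cssParts R j).2) :
    IsISGCode (cssSchedule R) T n k 2 := by
  refine ⟨hn, isStabilizerGroup_cssSchedule R, fun ρ => ?_⟩
  have key : ∀ j, T ≤ j → Group.rank (ρ.after (j + 1)) + k = n ∧
      Nonempty (LogicalPauliGroup (ρ.after (j + 1)) ≃* Pauli (Fin k)) ∧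
      (∀ p ∈ nontrivialLogicals (ρ.after (j + 1)), 2 ≤ p.weight) ∧
      ∃ p ∈ nontrivialLogicals (ρ.after (j + 1)), p.weight = 2 := by
    intro j hj
    obtain ⟨hS, h⟩ := ρ.after_spec hR j
    obtain ⟨Λ, i, hi⟩ := hΛ j hj
    -- After a round of `Z`s the first part is the `Z`-part, so everything is applied to `Λ.swap`.
    cases hb : (R j).basis <;> rw [hb] at h
    · obtain ⟨p, hp, hw⟩ := Λ.exists_nontrivialLogical hS h i
      exact ⟨by rw [rank_eq_of_symp_eq_prod hS h, hrank j hj], Λ.nonempty_mulEquiv hS h,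
        fun p hp => two_le_weight hS h (h₁ j hj) (h₂ j hj) hp, p, hp, hw.trans hi⟩
    · obtain ⟨p, hp, hw⟩ := Λ.swap.exists_nontrivialLogical' hS h i
      exact ⟨by rw [rank_eq_of_symp_eq_prod hS h, add_comm (Module.finrank _ _), hrank j hj],
        Λ.swap.nonempty_mulEquiv hS h,
        fun p hp => two_le_weight hS h (h₂ j hj) (h₁ j hj) hp, p, hp, hw.trans hi⟩
  refine ⟨fun t ht => ?_, ?_, ?_⟩
  · obtain ⟨j, hj, rfl, -⟩ := ρ.exists_isg_eq_after ht
    exact ⟨(ρ.after_spec hR j).1, (key j hj).1, (key j hj).2.1⟩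
  · obtain ⟨p, hp, hw⟩ := (key T le_rfl).2.2.2
    exact ⟨T, le_rfl, p, hp, hw⟩
  · rintro w ⟨t, ht, p, hp, rfl⟩
    obtain ⟨j, hj, rfl, e⟩ := ρ.exists_isg_eq_after ht
    rw [e] at hp
    exact (key j hj).2.2.1 p hp

theorem finrank_span_of_dual {r : ℕ} {a b : Fin r → Q → ZMod 2}
    (h : ∀ i j, a i ⬝ᵥ b j = if i = j then 1 else 0) :
    Module.finrank (ZMod 2) (Submodule.span (ZMod 2) (Set.range a)) = r := by
  rw [finrank_span_eq_card (linearIndependent_of_dual h), Fintype.card_fin]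

end CSS

/-! ## The `[[4,2,2]]` code -/

theorem charVec_univ_fin_four : charVec (Finset.univ : Finset (Fin 4)) = fun _ => 1 := by
  ext q; simp [charVec_apply]

theorem code422_basis (t : ZMod 2) : (code422 (t + 1)).basis = (code422 t).basis.flip := by
  have : ∀ t : ZMod 2, t = 0 ∨ t = 1 := by decide
  rcases this t with rfl | rfl <;> rfl

theorem code422_span (t : ZMod 2) :
    (code422 t).span = Submodule.span (ZMod 2) {fun _ => (1 : ZMod 2)} := by
  rw [CSSRound.span, ← charVec_univ_fin_four]
  simp [code422]

theorem cssParts_code422_snd_le (j : ℕ) :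
    (cssParts code422 j).2 ≤ Submodule.span (ZMod 2) {fun _ => (1 : ZMod 2)} := by
  have : ∀ j, (cssParts code422 j).1 ≤ Submodule.span (ZMod 2) {fun _ => (1 : ZMod 2)} ∧
      (cssParts code422 j).2 ≤ Submodule.span (ZMod 2) {fun _ => (1 : ZMod 2)} := by
    intro j
    induction j with
    | zero => exact ⟨(code422_span 0).le, bot_le⟩
    | succ j ih => exact ⟨sup_le (code422_span _).le ih.2, inf_le_left.trans ih.1⟩
  exact (this j).2

theorem cssParts_code422_fst (j : ℕ) :
    (cssParts code422 j).1 = Submodule.span (ZMod 2) {fun _ => (1 : ZMod 2)} := by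
  cases j with
  | zero => exact code422_span 0
  | succ j =>
    change _ ⊔ _ = _
    rw [code422_span, sup_eq_left]
    exact cssParts_code422_snd_le j

/-- The all-ones vector has even weight, so it is orthogonal to itself and survives the opposite
measurement. At `j = 0` nothing has been measured in the other basis yet. -/
theorem cssParts_code422_snd (j : ℕ) (hj : 1 ≤ j) :
    (cssParts code422 j).2 = Submodule.span (ZMod 2) {fun _ => (1 : ZMod 2)} := by
  obtain ⟨j, rfl⟩ := Nat.exists_eq_add_of_le' hj
  change _ ⊓ _ = _
  rw [code422_span, cssParts_code422_fst, inf_eq_left, Submodule.span_singleton_le_iff_mem,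
    mem_dotPerp_span]
  rintro _ rfl
  decide

/-- A basis of the space of four qubits that contains a stabilizer and two logical operators. -/
def basis422 : Fin 1 ⊕ Fin 2 ⊕ Fin 1 → Fin 4 → ZMod 2 :=
  Sum.elim ![![1, 1, 1, 1]] (Sum.elim ![![1, 1, 0, 0], ![1, 0, 1, 0]] ![![1, 0, 0, 0]])

/-- The dual basis. -/
def dualBasis422 : Fin 1 ⊕ Fin 2 ⊕ Fin 1 → Fin 4 → ZMod 2 :=
  Sum.elim ![![0, 0, 0, 1]] (Sum.elim ![![0, 1, 0, 1], ![0, 0, 1, 1]] ![![1, 1, 1, 1]])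

theorem isISGCode_code422 : IsISGCode (cssSchedule code422) 1 4 2 2 := by
  have h1 : ∀ u ∈ ({fun _ => (1 : ZMod 2)} : Set (Fin 4 → ZMod 2)), ∀ q,
      u ⬝ᵥ (Pi.single q 1 : Fin 4 → ZMod 2) = 1 := by
    rintro _ rfl q
    simp
  -- The premise never holds: a single qubit overlaps the full support oddly.
  have hs : ∀ (q : Fin 4) (A : Submodule (ZMod 2) (Fin 4 → ZMod 2)),
      (Pi.single q 1 : Fin 4 → ZMod 2) ∈
        dotPerp (Submodule.span (ZMod 2) {fun _ => (1 : ZMod 2)}) → Pi.single q 1 ∈ A := by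
    intro q A h
    rw [mem_dotPerp_span] at h
    have h0 := h _ rfl
    rw [h1 _ rfl q] at h0
    exact absurd h0 one_ne_zero
  have hfin : Module.finrank (ZMod 2)
      (Submodule.span (ZMod 2) {(fun _ => 1 : Fin 4 → ZMod 2)}) = 1 :=
    finrank_span_singleton fun h => one_ne_zero (congrFun h 0)
  have hrange : ∀ f : Fin 1 → Fin 4 → ZMod 2, f 0 = (fun _ => 1) →
      Submodule.span (ZMod 2) {fun _ => (1 : ZMod 2)} =
        Submodule.span (ZMod 2) (Set.range f) := by
    intro f hf
    rw [Set.range_unique]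
    exact congrArg (fun v => Submodule.span (ZMod 2) {v}) hf.symm
  refine isISGCode_two code422_basis rfl (fun j hj => ?_) (fun j hj => ?_) (fun j hj q => ?_)
    (fun j hj q => ?_)
  · rw [cssParts_code422_fst, cssParts_code422_snd j hj]
    refine ⟨LogicalBasis.ofDual (r := 1) (s := 1) (a := basis422) (b := dualBasis422) rfl
      (by decide) (hrange _ (by decide)) (hrange _ (by decide)), 0, ?_⟩
    change (Finset.univ.filter fun q => basis422 (.inr (.inl 0)) q ≠ 0).card = 2
    decide
  · rw [cssParts_code422_fst, cssParts_code422_snd j hj, hfin]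
  · rw [cssParts_code422_snd j hj]
    exact hs q _
  · rw [cssParts_code422_fst]
    exact hs q _

theorem isStabilizerSchedule_code422 : IsStabilizerSchedule (cssSchedule code422) := by
  let T : Set (Pauli (Fin 4)) := {Basis.X.pauli Finset.univ, Basis.Z.pauli Finset.univ}
  have hle : ⨆ t, cssSchedule code422 t ≤ Subgroup.closure T := by
    refine iSup_le fun t => ?_
    rw [cssSchedule, CSSRound.paulis_eq, Subgroup.closure_le]
    rintro _ ⟨S, hS, rfl⟩
    simp only [code422, Finset.coe_singleton, Set.mem_singleton_iff] at hS
    subst hS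
    apply Subgroup.subset_closure
    cases (code422 (t : ZMod 2)).basis
    · exact Or.inl rfl
    · exact Or.inr rfl
  have hc : Commute (Basis.X.pauli (Finset.univ : Finset (Fin 4))) (Basis.Z.pauli Finset.univ) := by
    rw [Pauli.commute_iff]
    change charVec Finset.univ ⬝ᵥ charVec Finset.univ + (0 : Fin 4 → ZMod 2) ⬝ᵥ 0 = 0
    rw [charVec_univ_fin_four]
    decide
  have hT : ∀ a ∈ T, ∀ b ∈ T, a * b = b * a := by
    rintro a (rfl | rfl) b (rfl | rfl)
    · rfl
    · exact hc.eq
    · exact hc.eq.symm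
    · rfl
  intro a ha b hb
  have := Subgroup.isMulCommutative_closure hT
  have h := this.is_comm.comm (⟨a, hle ha⟩ : Subgroup.closure T) ⟨b, hle hb⟩
  exact congrArg Subtype.val h

/-! ## The double hexagon code -/

/-- The support of `hexStabilizer t`. -/
def hexSupport (t : ZMod 6) : Finset (ZMod 6 × ZMod 2) :=
  {(t, 0), (t, 1), (t - 1, 0), (t - 1, 1), (t - 2, 0), (t - 2, 1)}

theorem hexStabilizer_eq (t : ZMod 6) : hexStabilizer t = (hexBasis t).pauli (hexSupport t) := rfl

/-- The characteristic vector of a set of qubits of the double hexagon code. -/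
def hexVec (S : Finset (ZMod 6 × ZMod 2)) (q : ZMod 6 × ZMod 2) : ZMod 2 := if q ∈ S then 1 else 0

theorem charVec_eq_hexVec : charVec = hexVec := by
  ext S q; exact charVec_apply S q

/-! ### Dual frames of the double hexagon code -/

/-- A basis of the space of twelve qubits that contains eight stabilizers of the type measured at
time `t` and two logical operators. -/
def hexFrame : Fin 8 ⊕ Fin 2 ⊕ Fin 2 → Finset (ZMod 6 × ZMod 2) :=
  Sum.elim
    ![{(0, 0)}, {(0, 1)}, {(1, 0), (2, 0)}, {(1, 1), (2, 1)}, {(3, 0), (3, 1)}, {(4, 0), (5, 0)},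
      {(4, 1), (5, 1)}, {(4, 0), (4, 1), (3, 0), (3, 1), (2, 0), (2, 1)}]
    (Sum.elim ![{(1, 0), (1, 1)}, {(1, 0), (3, 0), (4, 0)}] ![{(5, 0)}, {(1, 0)}])

/-- The dual basis. -/
def hexDualFrame : Fin 8 ⊕ Fin 2 ⊕ Fin 2 → Finset (ZMod 6 × ZMod 2) :=
  Sum.elim
    ![{(0, 0)}, {(0, 1)}, {(2, 0), (4, 1), (5, 1)}, {(2, 1), (4, 1), (5, 1)},
      {(3, 1), (4, 1), (5, 1)}, {(3, 0), (3, 1), (4, 0), (4, 1), (5, 1)}, {(5, 1)},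
      {(4, 1), (5, 1)}]
    (Sum.elim ![{(1, 1), (2, 1), (4, 1), (5, 1)}, {(3, 0), (3, 1)}]
      ![{(3, 0), (3, 1), (4, 0), (4, 1), (5, 0), (5, 1)},
        {(1, 0), (1, 1), (2, 0), (2, 1), (3, 0), (3, 1)}])

/-- The frame at time `t`. -/
def hexA (t : ZMod 6) (i : Fin 8 ⊕ Fin 2 ⊕ Fin 2) (q : ZMod 6 × ZMod 2) : ZMod 2 :=
  hexVec (hexFrame i) (q.1 - t, q.2)

/-- The dual frame at time `t`. -/
def hexB (t : ZMod 6) (i : Fin 8 ⊕ Fin 2 ⊕ Fin 2) (q : ZMod 6 × ZMod 2) : ZMod 2 :=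
  hexVec (hexDualFrame i) (q.1 - t, q.2)

/-- Both frames are translates of those at time `0`, so only one duality table has to be checked. -/
theorem hexA_dotProduct_hexB (t : ZMod 6) (i j : Fin 8 ⊕ Fin 2 ⊕ Fin 2) :
    hexA t i ⬝ᵥ hexB t j = if i = j then 1 else 0 := by
  have h : ∀ i j, hexA 0 i ⬝ᵥ hexB 0 j = if i = j then 1 else 0 := by decide +kernel
  rw [← h]
  exact Fintype.sum_equiv ((Equiv.subRight t).prodCongr (Equiv.refl _)) _ _ fun q => by
    simp [hexA, hexB]

theorem image_supports_doubleHexagon :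
    ∀ t, (doubleHexagon t).supports.image hexVec ∪ {hexVec (hexSupport (t - 2))} =
      Finset.univ.image fun i => hexA t (.inl i) := by
  decide +kernel

theorem hexVec_hexSupport :
    ∀ t, hexVec (hexSupport (t - 1)) = hexB t (.inr (.inr 0)) ∧
      hexVec (hexSupport (t - 3)) = hexB t (.inr (.inr 1)) := by
  decide +kernel

theorem hexBasis_add_one (t : ZMod 6) : hexBasis (t + 1) = (hexBasis t).flip := by
  have : ∀ t : ZMod 6, Even (t + 1).val ↔ ¬ Even t.val := by decide
  unfold hexBasis
  rw [if_congr (this t) rfl rfl]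
  split_ifs <;> simp_all [Basis.flip]

theorem hexBasis_sub_one (t : ZMod 6) : hexBasis (t - 1) = (hexBasis t).flip := by
  rw [← sub_add_cancel t 1, hexBasis_add_one, add_sub_cancel_right]
  cases hexBasis (t - 1) <;> rfl

theorem doubleHexagon_basis (t : ZMod 6) :
    (doubleHexagon (t + 1)).basis = (doubleHexagon t).basis.flip := hexBasis_add_one t

theorem charVec_mem_span {t : ZMod 6} {S : Finset (ZMod 6 × ZMod 2)}
    (hS : S ∈ (doubleHexagon t).supports) : hexVec S ∈ (doubleHexagon t).span := by
  rw [← charVec_eq_hexVec]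
  exact Submodule.subset_span ⟨S, hS, rfl⟩

/-- The stabilizers of the type measured at time `t`. -/
theorem span_sup_hexSupport (t : ZMod 6) :
    (doubleHexagon t).span ⊔ Submodule.span (ZMod 2) {hexVec (hexSupport (t - 2))} =
      Submodule.span (ZMod 2) (Set.range fun i => hexA t (.inl i)) := by
  have h := congrArg (fun s : Finset _ => (s : Set (ZMod 6 × ZMod 2 → ZMod 2)))
    (image_supports_doubleHexagon t)
  simp only [Finset.coe_union, Finset.coe_image, Finset.coe_singleton, Finset.coe_univ,
    Set.image_univ] at h
  rw [← h, Submodule.span_union, ← charVec_eq_hexVec]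
  rfl

/-- The stabilizers of the type not measured at time `t`. -/
theorem span_hexSupport_pair (t : ZMod 6) :
    Submodule.span (ZMod 2) {hexVec (hexSupport (t - 1)), hexVec (hexSupport (t - 3))} =
      Submodule.span (ZMod 2) (Set.range fun i => hexB t (.inr (.inr i))) := by
  rw [(hexVec_hexSupport t).1, (hexVec_hexSupport t).2]
  congr 1
  ext v
  simp [Fin.exists_fin_two, eq_comm]

/-! ### Creation and survival of the weight-six stabilizers -/

theorem hexSupport_mem_span (t : ZMod 6) : hexVec (hexSupport t) ∈ (doubleHexagon t).span := by
  have h : ∀ t, hexVec (hexSupport t) =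
      hexVec {(t, 0)} + hexVec {(t, 1)} + hexVec {(t + 4, 0), (t + 5, 0)} +
        hexVec {(t + 4, 1), (t + 5, 1)} := by decide +kernel
  rw [h]
  refine add_mem (add_mem (add_mem ?_ ?_) ?_) ?_ <;>
    exact charVec_mem_span (by simp [doubleHexagon])

/-- As indices are modulo six, this is `s_{t-4}`: a round measures it anew, so it is no additional
generator. -/
theorem hexSupport_add_two_mem_span (t : ZMod 6) :
    hexVec (hexSupport (t + 2)) ∈ (doubleHexagon t).span := by
  have h : ∀ t, hexVec (hexSupport (t + 2)) =
      hexVec {(t, 0)} + hexVec {(t, 1)} + hexVec {(t + 1, 0), (t + 2, 0)} +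
        hexVec {(t + 1, 1), (t + 2, 1)} := by decide +kernel
  rw [h]
  refine add_mem (add_mem (add_mem ?_ ?_) ?_) ?_ <;>
    exact charVec_mem_span (by simp [doubleHexagon])

theorem hexSupport_mem_dotPerp (t : ZMod 6) :
    hexVec (hexSupport (t - 1)) ∈ dotPerp (doubleHexagon t).span ∧
      hexVec (hexSupport (t - 3)) ∈ dotPerp (doubleHexagon t).span := by
  have h : ∀ t, (doubleHexagon t).supports.image (fun S =>
      (hexVec S ⬝ᵥ hexVec (hexSupport (t - 1)), hexVec S ⬝ᵥ hexVec (hexSupport (t - 3)))) =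
        {(0, 0)} := by decide +kernel
  have h' : ∀ S ∈ (doubleHexagon t).supports,
      (hexVec S ⬝ᵥ hexVec (hexSupport (t - 1)), hexVec S ⬝ᵥ hexVec (hexSupport (t - 3))) = (0, 0) :=
    fun S hS => by
    rw [← Finset.mem_singleton, ← h t]
    exact Finset.mem_image_of_mem (fun S => (_, _)) hS
  simp only [CSSRound.span, mem_dotPerp_span, charVec_eq_hexVec]
  constructor
  · rintro _ ⟨S, hS, rfl⟩
    exact (Prod.mk.inj (h' S hS)).1
  · rintro _ ⟨S, hS, rfl⟩
    exact (Prod.mk.inj (h' S hS)).2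

/-- Six measurements at time `t + 1`. -/
def hexCheck (t : ZMod 6) : Fin 6 → Finset (ZMod 6 × ZMod 2) :=
  ![{(t + 1, 0)}, {(t + 1, 1)}, {(t + 2, 0), (t + 3, 0)}, {(t + 4, 0), (t + 4, 1)},
    {(t + 5, 0), (t, 0)}, {(t + 5, 1), (t, 1)}]

/-- Vectors such that subtracting `hexShift t k` for each `hexCheck t k` that anticommutes with a
stabilizer of time `t` leaves a combination of `hexStabilizer t` and `hexStabilizer (t - 2)`. -/
def hexShift (t : ZMod 6) : Fin 6 → Finset (ZMod 6 × ZMod 2) :=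
  ![{(t + 1, 0), (t + 2, 0), (t + 3, 0), (t + 3, 1)}, {(t + 1, 1), (t + 2, 1)},
    {(t + 3, 0), (t + 3, 1)}, {(t, 1), (t + 4, 1), (t + 5, 1)}, {(t, 0)}, {(t, 1)}]

theorem hexCheck_mem_supports :
    ∀ t i, hexCheck t i ∈ (doubleHexagon (t + 1)).supports := by decide +kernel

/-- The map `v ↦ v + ∑ k, (check k ⬝ᵥ v) • shift k` is linear and fixes every `v` orthogonal to the
checks. It therefore suffices that it sends the eight generators into the asserted span, a finite
check. Six of the seven measurements are enough, as the dimension is to drop from eight to two. -/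
theorem inf_dotPerp_le (t : ZMod 6) :
    ((doubleHexagon t).span ⊔ Submodule.span (ZMod 2) {hexVec (hexSupport (t - 2))}) ⊓
        dotPerp (doubleHexagon (t + 1)).span ≤
      Submodule.span (ZMod 2) {hexVec (hexSupport t), hexVec (hexSupport (t - 2))} := by
  have h : ∀ t i,
      hexA t (.inl i) + ∑ k, (hexVec (hexCheck t k) ⬝ᵥ hexA t (.inl i)) • hexVec (hexShift t k) ∈
        ({0, hexVec (hexSupport t), hexVec (hexSupport (t - 2))} : Finset _) := by
    decide +kernel
  rw [span_sup_hexSupport]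
  rintro v ⟨hv, hp⟩
  have h' : ∀ v ∈ Submodule.span (ZMod 2) (Set.range fun i => hexA t (.inl i)),
      v + ∑ k, (hexVec (hexCheck t k) ⬝ᵥ v) • hexVec (hexShift t k) ∈
        Submodule.span (ZMod 2) {hexVec (hexSupport t), hexVec (hexSupport (t - 2))} := by
    intro v hv
    induction hv using Submodule.span_induction with
    | mem v hv =>
      obtain ⟨i, rfl⟩ := hv
      have := h t i
      simp only [Finset.mem_insert, Finset.mem_singleton] at this
      rcases this with e | e | e <;> rw [e]
      · exact Submodule.zero_mem _
      · exact Submodule.subset_span (by simp)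
      · exact Submodule.subset_span (by simp)
    | zero => simp
    | add a b _ _ ha hb =>
      have := add_mem ha hb
      simp only [dotProduct_add, add_smul, Finset.sum_add_distrib]
      rwa [add_add_add_comm] at this
    | smul c a _ ha =>
      have := Submodule.smul_mem _ c ha
      rw [smul_add, Finset.smul_sum] at this
      simpa only [dotProduct_smul, smul_smul, smul_eq_mul] using this
  have := h' v hv
  rwa [Finset.sum_eq_zero fun k _ => by
    rw [hp _ (charVec_mem_span (hexCheck_mem_supports t k)), zero_smul], add_zero] at this

/-- These upper bounds hold from the start; only the reverse inclusions need three timesteps. -/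
theorem cssParts_doubleHexagon_le (j : ℕ) :
    (cssParts doubleHexagon j).1 ≤
        (doubleHexagon j).span ⊔ Submodule.span (ZMod 2) {hexVec (hexSupport (j - 2))} ∧
      (cssParts doubleHexagon j).2 ≤
        Submodule.span (ZMod 2) {hexVec (hexSupport (j - 1)), hexVec (hexSupport (j - 3))} := by
  induction j with
  | zero =>
    refine ⟨?_, bot_le⟩
    rw [Nat.cast_zero]
    exact le_sup_left
  | succ j ih =>
    rw [Nat.cast_succ, add_sub_cancel_right, show (j + 1 - 3 : ZMod 6) = j - 2 by ring,
      show (j + 1 - 2 : ZMod 6) = j - 1 by ring]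
    simp only [cssParts, Nat.cast_succ]
    constructor
    · refine sup_le le_sup_left (ih.2.trans ?_)
      rw [Submodule.span_insert, sup_comm]
      refine sup_le_sup ?_ le_rfl
      -- Modulo six, `j - 3` is `(j + 1) + 2`, so this stabilizer is a product of measurements of
      -- round `j + 1`.
      rw [Submodule.span_singleton_le_iff_mem, show (j - 3 : ZMod 6) = j + 1 + 2 by
        rw [add_assoc, sub_eq_add_neg]; congr 1]
      exact hexSupport_add_two_mem_span _
    · exact (inf_le_inf_right _ ih.1).trans (inf_dotPerp_le _)

/-- Each `s_t` is created at time `t` and moves to the other part at each of the next three rounds.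
Its four ages are the four claims, and the last one accounts for the bound `3`. -/
theorem hexSupport_mem_cssParts (j : ℕ) :
    hexVec (hexSupport j) ∈ (cssParts doubleHexagon j).1 ∧
    (1 ≤ j → hexVec (hexSupport (j - 1)) ∈ (cssParts doubleHexagon j).2) ∧
    (2 ≤ j → hexVec (hexSupport (j - 2)) ∈ (cssParts doubleHexagon j).1) ∧
    (3 ≤ j → hexVec (hexSupport (j - 3)) ∈ (cssParts doubleHexagon j).2) := by
  induction j with
  | zero =>
    refine ⟨?_, by omega, by omega, by omega⟩
    rw [Nat.cast_zero]
    exact hexSupport_mem_span 0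
  | succ j ih =>
    obtain ⟨h0, h1, h2, -⟩ := ih
    have hp := hexSupport_mem_dotPerp (j + 1)
    rw [add_sub_cancel_right, show (j + 1 - 3 : ZMod 6) = j - 2 by ring] at hp
    rw [Nat.cast_succ, add_sub_cancel_right, show (j + 1 - 3 : ZMod 6) = j - 2 by ring,
      show (j + 1 - 2 : ZMod 6) = j - 1 by ring]
    simp only [cssParts, Nat.cast_succ]
    exact ⟨Submodule.mem_sup_left (hexSupport_mem_span _), fun _ => ⟨h0, hp.1⟩,
      fun hj => Submodule.mem_sup_right (h1 (by omega)), fun hj => ⟨h2 (by omega), hp.2⟩⟩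

theorem span_le_cssParts_fst {Q : Type} [Fintype Q] {ℓ : ℕ} (R : ZMod ℓ → CSSRound Q) (j : ℕ) :
    (R j).span ≤ (cssParts R j).1 := by
  cases j with
  | zero => rw [Nat.cast_zero]; exact le_rfl
  | succ j => exact le_sup_left

theorem cssParts_doubleHexagon {j : ℕ} (hj : 3 ≤ j) :
    cssParts doubleHexagon j =
      ((doubleHexagon j).span ⊔ Submodule.span (ZMod 2) {hexVec (hexSupport (j - 2))},
        Submodule.span (ZMod 2) {hexVec (hexSupport (j - 1)), hexVec (hexSupport (j - 3))}) := by
  obtain ⟨h, h'⟩ := cssParts_doubleHexagon_le j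
  obtain ⟨-, h1, h2, h3⟩ := hexSupport_mem_cssParts j
  refine Prod.ext (le_antisymm h (sup_le (span_le_cssParts_fst _ _) ?_)) (le_antisymm h' ?_)
  · rw [Submodule.span_singleton_le_iff_mem]
    exact h2 (by omega)
  · rw [Submodule.span_le]
    rintro _ (rfl | rfl)
    · exact h1 (by omega)
    · exact h3 hj

theorem cssParts_doubleHexagon_eq_span {j : ℕ} (hj : 3 ≤ j) :
    (cssParts doubleHexagon j).1 =
        Submodule.span (ZMod 2) (Set.range fun i => hexA j (.inl i)) ∧
      (cssParts doubleHexagon j).2 =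
        Submodule.span (ZMod 2) (Set.range fun i => hexB j (.inr (.inr i))) := by
  rw [cssParts_doubleHexagon hj, ← span_sup_hexSupport, ← span_hexSupport_pair]
  exact ⟨rfl, rfl⟩

theorem finrank_cssParts_doubleHexagon {j : ℕ} (hj : 3 ≤ j) :
    Module.finrank (ZMod 2) (cssParts doubleHexagon j).1 = 8 ∧
      Module.finrank (ZMod 2) (cssParts doubleHexagon j).2 = 2 := by
  rw [(cssParts_doubleHexagon_eq_span hj).1, (cssParts_doubleHexagon_eq_span hj).2]
  constructor
  · refine finrank_span_of_dual (b := fun i => hexB j (.inl i)) fun i k => ?_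
    rw [hexA_dotProduct_hexB]; simp
  · refine finrank_span_of_dual (b := fun i => hexA j (.inr (.inr i))) fun i k => ?_
    rw [dotProduct_comm, hexA_dotProduct_hexB]; simp [eq_comm]

theorem isISGCode_doubleHexagon : IsISGCode (cssSchedule doubleHexagon) 3 12 2 2 := by
  refine isISGCode_two doubleHexagon_basis rfl (fun j hj => ?_) (fun j hj => ?_)
    (fun j hj q hq => ?_) (fun j hj q hq => ?_)
  · refine ⟨LogicalBasis.ofDual (a := hexA j) (b := hexB j) rfl (hexA_dotProduct_hexB j)
      (cssParts_doubleHexagon_eq_span hj).1 (cssParts_doubleHexagon_eq_span hj).2, 0, ?_⟩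
    -- The weight-two logical operator is supported on `(t + 1, 0)` and `(t + 1, 1)`.
    have : ∀ t, (Finset.univ.filter fun q => hexA t (.inr (.inl 0)) q ≠ 0).card = 2 := by
      decide +kernel
    exact this j
  · rw [(finrank_cssParts_doubleHexagon hj).1, (finrank_cssParts_doubleHexagon hj).2]
  -- The supports of `s_{t-1}` and `s_{t-3}` cover all qubits except `(t, 0)` and `(t, 1)`, and
  -- these two are measured individually.
  · have h : ∀ (t : ZMod 6) (q : ZMod 6 × ZMod 2),
        (∃ i, hexB t (.inr (.inr i)) ⬝ᵥ Pi.single q 1 = 1) ∨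
          ∃ i, Pi.single q 1 = hexA t (.inl i) := by decide +kernel
    rw [(cssParts_doubleHexagon_eq_span hj).2, mem_dotPerp_span] at hq
    rw [(cssParts_doubleHexagon_eq_span hj).1]
    rcases h j q with ⟨i, hi⟩ | ⟨i, hi⟩
    · rw [hq _ ⟨i, rfl⟩] at hi
      exact absurd hi zero_ne_one
    · rw [hi]
      exact Submodule.subset_span ⟨i, rfl⟩
  · have h : ∀ (t : ZMod 6) (q : ZMod 6 × ZMod 2),
        ∃ i, hexA t (.inl i) ⬝ᵥ Pi.single q 1 = 1 := by decide +kernel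
    rw [(cssParts_doubleHexagon_eq_span hj).1, mem_dotPerp_span] at hq
    obtain ⟨i, hi⟩ := h j q
    rw [hq _ ⟨i, rfl⟩] at hi
    exact absurd hi zero_ne_one

theorem hasPeriod_doubleHexagon : HasPeriod (cssSchedule doubleHexagon) 6 := by
  constructor
  · refine ⟨by norm_num, fun t => ?_⟩
    simp only [cssSchedule, Nat.cast_add]
    rw [show ((6 : ℕ) : ZMod 6) = 0 from rfl, add_zero]
  · rintro j ⟨hj, h⟩
    by_contra hlt
    have h0 := congrArg symp (h 0)
    rw [zero_add, cssSchedule, cssSchedule, CSSRound.symp_closure_paulis,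
      CSSRound.symp_closure_paulis, Nat.cast_zero] at h0
    have hmem : hexVec {(0, 0)} ∈ (doubleHexagon 0).span :=
      charVec_mem_span (by simp [doubleHexagon])
    have h1 : (hexVec {(0, 0)}, 0) ∈ (doubleHexagon j).basis.prod (doubleHexagon j).span ⊥ :=
      h0 ▸ ⟨hmem, rfl⟩
    have hne : hexVec {(0, 0)} ≠ 0 := by decide
    -- A vector orthogonal to all measurements of round `t`, but not to the qubit `(0, 0)`, shows
    -- that this qubit is not in their span. Such vectors rule out the periods `2` and `4`; an odd
    -- period is ruled out by the change of basis.
    have hS : ∀ t : ZMod 6, ∀ S, (doubleHexagon t).supports.image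
        (fun S' => hexVec S' ⬝ᵥ hexVec S) = {0} → hexVec {(0, 0)} ⬝ᵥ hexVec S = 1 →
        hexVec {(0, 0)} ∉ (doubleHexagon t).span := by
      intro t S hS hS' hm
      have : hexVec S ∈ dotPerp (doubleHexagon t).span := by
        rw [CSSRound.span, mem_dotPerp_span, charVec_eq_hexVec]
        rintro _ ⟨S', hS'', rfl⟩
        exact Finset.mem_singleton.1
          (hS ▸ Finset.mem_image_of_mem (fun S' => hexVec S' ⬝ᵥ hexVec S) hS'')
      rw [this _ hm] at hS'
      exact zero_ne_one hS'
    have hj' : j < 6 := by omega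
    interval_cases j
    · exact hne h1.1
    · exact hS 2 {(0, 0), (1, 0)} (by decide +kernel) (by decide) h1.1
    · exact hne h1.1
    · exact hS 4 {(0, 0), (5, 0)} (by decide +kernel) (by decide) h1.1
    · exact hne h1.1

theorem weight_of_mem_paulis_doubleHexagon (t : ZMod 6) :
    ∀ p ∈ (doubleHexagon t).paulis, p.weight = 1 ∨ p.weight = 2 := by
  have h : ∀ t, (doubleHexagon t).supports.image Finset.card = {1, 2} := by decide +kernel
  rintro _ ⟨S, hS, rfl⟩
  rw [Basis.weight_pauli]
  have := h t ▸ Finset.mem_image_of_mem Finset.card hS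
  simpa using this

theorem card_supports_doubleHexagon : ∀ t, (doubleHexagon t).supports.card = 7 := by decide +kernel

/-- The Paulis that generate the instantaneous stabilizer group up to signs. -/
def hexGenerators (t : ZMod 6) : Set (Pauli (ZMod 6 × ZMod 2)) :=
  (doubleHexagon t).paulis ∪ {hexStabilizer (t - 1), hexStabilizer (t - 2), hexStabilizer (t - 3)}

theorem mul_self_of_mem_hexGenerators {t : ZMod 6} {p : Pauli (ZMod 6 × ZMod 2)}
    (hp : p ∈ hexGenerators t) : p * p = 1 := by
  rcases hp with ⟨S, -, rfl⟩ | rfl | rfl | rfl <;> exact Basis.pauli_mul_self _ _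

theorem span_vec_hexGenerators (t : ZMod 6) :
    Submodule.span (ZMod 2) (Pauli.vec '' hexGenerators t) =
      (hexBasis t).prod
        ((doubleHexagon t).span ⊔ Submodule.span (ZMod 2) {hexVec (hexSupport (t - 2))})
        (Submodule.span (ZMod 2) {hexVec (hexSupport (t - 1)), hexVec (hexSupport (t - 3))}) := by
  have h : hexGenerators t =
      (hexBasis t).pauli '' ((doubleHexagon t).supports ∪ {hexSupport (t - 2)}) ∪
        (hexBasis t).flip.pauli '' {hexSupport (t - 1), hexSupport (t - 3)} := by
    have h1 := hexBasis_sub_one t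
    have h2 := hexBasis_sub_one (t - 1)
    have h3 := hexBasis_sub_one (t - 2)
    rw [show t - 1 - 1 = t - 2 by ring, h1] at h2
    rw [show t - 2 - 1 = t - 3 by ring, h2] at h3
    have hf : ∀ b : Basis, b.flip.flip = b := by rintro (_ | _) <;> rfl
    rw [hf] at h2 h3
    rw [hexGenerators, CSSRound.paulis_eq, hexStabilizer_eq, hexStabilizer_eq, hexStabilizer_eq,
      h1, h2, h3, Set.image_union, Set.image_singleton, Set.image_pair]
    ext p
    simp only [Set.mem_union, Set.mem_insert_iff, Set.mem_singleton_iff]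
    tauto
  rw [h, Set.image_union, Submodule.span_union, Basis.span_vec_pauli, Basis.span_vec_pauli,
    Basis.prod_flip, Basis.prod_sup_prod, sup_bot_eq, bot_sup_eq, Set.image_union,
    Submodule.span_union, Set.image_singleton, Set.image_pair, charVec_eq_hexVec, CSSRound.span,
    charVec_eq_hexVec]

theorem doubleHexagon_isg (ρ : Run (cssSchedule doubleHexagon)) (t : ℤ) (ht : 3 ≤ t) :
    Group.rank (ρ.isg t) = 10 ∧ (hexGenerators t).ncard = 10 ∧
      ∃ ε : Pauli (ZMod 6 × ZMod 2) → ℤˣ,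
        ρ.isg t = Subgroup.closure ((fun p => p.signed (ε p)) '' hexGenerators t) := by
  obtain ⟨j, hj, rfl, e⟩ := ρ.exists_isg_eq_after (T := 3) ht
  obtain ⟨hS, h⟩ := ρ.after_spec doubleHexagon_basis j
  rw [← e] at hS h
  have hspan : symp (ρ.isg j) = Submodule.span (ZMod 2) (Pauli.vec '' hexGenerators (j : ℤ)) := by
    rw [h, Int.cast_natCast, span_vec_hexGenerators, cssParts_doubleHexagon hj]
    rfl
  have hrank : Group.rank (ρ.isg j) = 10 := by
    obtain ⟨h1, h2⟩ := finrank_cssParts_doubleHexagon hj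
    cases hb : (doubleHexagon j).basis <;> rw [hb] at h
    · rw [rank_eq_of_symp_eq_prod hS h, h1, h2]
    · rw [rank_eq_of_symp_eq_prod hS h, h1, h2]
  obtain ⟨ε, hε⟩ := hS.exists_eq_closure_signed (fun p => mul_self_of_mem_hexGenerators) hspan
  refine ⟨hrank, le_antisymm ?_ ?_, ε, hε⟩
  · refine (Set.ncard_union_le _ _).trans (add_le_add (b := 7) (d := 3) ?_ ?_)
    · rw [CSSRound.paulis_eq]
      refine (Set.ncard_image_le (Finset.finite_toSet _)).trans ?_
      rw [Set.ncard_coe_finset, card_supports_doubleHexagon]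
    · refine (Set.ncard_insert_le _ _).trans (Nat.succ_le_succ ?_)
      refine (Set.ncard_insert_le _ _).trans (Nat.succ_le_succ ?_)
      rw [Set.ncard_singleton]
  -- The generators are distinct because a group of rank ten needs ten of them.
  · rw [← hrank, Subgroup.rank_congr hε]
    have := Subgroup.rank_closure_finite_le_nat_card
      ((fun p : Pauli (ZMod 6 × ZMod 2) => p.signed (ε p)) '' hexGenerators (j : ℤ))
    exact this.trans (Set.ncard_image_le (Set.toFinite _))

/-! ## The ZX-diagram of the double hexagon code -/

/-- The colour of the spiders on the world-lines of the double hexagon code at time `t`. -/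
def timeBasis (t : ℤ) : Basis := if Even t then .X else .Z

theorem timeBasis_of_even_iff {t u : ℤ} (h : Even t ↔ Even u) : timeBasis t = timeBasis u :=
  if_congr h rfl rfl

theorem timeBasis_flip_of_even_iff {t u : ℤ} (h : Even t ↔ ¬ Even u) :
    (timeBasis t).flip = timeBasis u := by
  unfold timeBasis
  split_ifs <;> first | rfl | (exfalso; tauto)

theorem hexBasis_intCast (t : ℤ) : hexBasis t = timeBasis t := by
  have h : ((t : ZMod 6).val : ℤ) = t % 6 := ZMod.val_intCast t
  refine if_congr ?_ rfl rfl
  rw [← Int.even_coe_nat, h, Int.even_iff, Int.even_iff]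
  omega

/-- The two schedules begin with opposite bases, which explains the shift by one. -/
theorem code422_basis_intCast (t : ℤ) : (code422 t).basis = timeBasis (t + 1) := by
  have h : (t : ZMod 2) = 0 ↔ Even t := by
    rw [ZMod.intCast_zmod_eq_zero_iff_dvd, even_iff_two_dvd, Nat.cast_ofNat]
  have h2 : Even (t + 1) ↔ ¬ Even t := by
    rw [Int.even_add_one]
  unfold code422 timeBasis
  simp only [h, h2]
  split_ifs <;> simp_all

namespace ZXDiagram

/-- A ZX-diagram without open ends and phases. -/
noncomputable def phaseFree (Spider Leg : Type) (colour : Spider → Basis) (spider : Leg → Spider)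
    (mate : Leg → Leg) (mate_mate : ∀ l, mate (mate l) = l) (mate_ne : ∀ l, mate l ≠ l)
    (finite_legs : ∀ v, {l | spider l = v}.Finite) : ZXDiagram Empty where
  Spider := Spider
  Leg := Leg
  colour := colour
  phase _ := 0
  node l := .inl (spider l)
  mate := mate
  mate_mate := mate_mate
  mate_ne := mate_ne
  finite_legs v := by simpa using finite_legs v
  open_ends b := b.elim

end ZXDiagram

/-! ### Removing the outcome spiders of weight-two measurements -/

/-- The other qubit of the measurement at time `t` that involves `q`, or `q` itself if there is
none. -/
def hexPartner (t : ZMod 6) (q : ZMod 6 × ZMod 2) : ZMod 6 × ZMod 2 :=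
  if t - q.1 = 0 then q else if t - q.1 = 3 then (q.1, q.2 + 1)
  else if t - q.1 = 1 ∨ t - q.1 = 4 then (q.1 - 1, q.2) else (q.1 + 1, q.2)

theorem hexPartner_hexPartner : ∀ t q, hexPartner t (hexPartner t q) = q := by decide +kernel

theorem hexPartner_fst : ∀ t q, q.1 ≠ t → (hexPartner t q).1 ≠ t := by decide +kernel

theorem hexPartner_ne : ∀ t q, q.1 ≠ t → hexPartner t q ≠ q := by decide +kernel

theorem hexPartner_self : ∀ t j, hexPartner t (t, j) = (t, j) := by decide +kernel

/-- The support of the measurement at time `t` that involves `q`. -/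
def hexCell (t : ZMod 6) (q : ZMod 6 × ZMod 2) : Finset (ZMod 6 × ZMod 2) := {q, hexPartner t q}

/-- The supports of a round partition the twelve qubits, so a qubit determines its measurement and
`WireLeg.inner` needs no support as an argument. -/
theorem filter_supports_doubleHexagon :
    ∀ t q, ((doubleHexagon t).supports.filter fun S => q ∈ S) = {hexCell t q} := by
  decide +kernel

theorem hexCell_mem (t : ZMod 6) (q : ZMod 6 × ZMod 2) :
    hexCell t q ∈ (doubleHexagon t).supports := by
  have := (filter_supports_doubleHexagon t q).ge (Finset.mem_singleton_self _)
  exact (Finset.mem_filter.1 this).1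

theorem mem_hexCell (t : ZMod 6) (q : ZMod 6 × ZMod 2) : q ∈ hexCell t q :=
  Finset.mem_insert_self _ _

theorem eq_hexCell {t : ZMod 6} {q : ZMod 6 × ZMod 2} {S : Finset (ZMod 6 × ZMod 2)}
    (hS : S ∈ (doubleHexagon t).supports) (hq : q ∈ S) : S = hexCell t q :=
  Finset.mem_singleton.1 (filter_supports_doubleHexagon t q ▸ Finset.mem_filter.2 ⟨hS, hq⟩)

theorem mem_hexCell_self {t : ZMod 6} {j : ZMod 2} {q : ZMod 6 × ZMod 2} :
    q ∈ hexCell t (t, j) ↔ q = (t, j) := by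
  simp [hexCell, hexPartner_self]

theorem supports_doubleHexagon_nonempty {t : ZMod 6} {S : Finset (ZMod 6 × ZMod 2)}
    (hS : S ∈ (doubleHexagon t).supports) : S.Nonempty := by
  have h : ∀ t, ∅ ∉ (doubleHexagon t).supports := by decide +kernel
  rw [Finset.nonempty_iff_ne_empty]
  rintro rfl
  exact h t hS

/-- The spiders that are left when the two-legged spiders of the measurements of weight two are
removed: `state t j` belongs to the measurement of the single qubit `(t, j)`. -/
inductive WireSpider
  | qubit (t : ℤ) (q : ZMod 6 × ZMod 2)
  | state (t : ℤ) (j : ZMod 2)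

/-- The half-wires that are left when the two-legged spiders of the measurements of weight two are
removed. -/
inductive WireLeg
  | below (t : ℤ) (q : ZMod 6 × ZMod 2)
  | above (t : ℤ) (q : ZMod 6 × ZMod 2)
  | inner (t : ℤ) (q : ZMod 6 × ZMod 2)
  | outer (t : ℤ) (j : ZMod 2)

namespace WireLeg

/-- The spider at which a half-wire is attached. -/
def spider : WireLeg → WireSpider
  | below t q => .qubit t q
  | above t q => .qubit t q
  | inner t q => .qubit t q
  | outer t j => .state t j

/-- The other half of a wire. -/
def mate : WireLeg → WireLeg
  | below t q => above (t - 1) q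
  | above t q => below (t + 1) q
  | inner t q => if q.1 = t then outer t q.2 else inner t (hexPartner t q)
  | outer t j => inner t (t, j)

theorem mate_inner_of_ne {t : ℤ} {q : ZMod 6 × ZMod 2} (h : q.1 ≠ t) :
    mate (inner t q) = inner t (hexPartner t q) := if_neg h

theorem mate_inner_self (t : ℤ) (j : ZMod 2) : mate (inner t (t, j)) = outer t j := if_pos rfl

end WireLeg

/-- The diagram of the double hexagon code without the two-legged spiders of the measurements of
weight two. -/
noncomputable def wireDiagram : ZXDiagram Empty :=
  .phaseFree WireSpider WireLeg
    (fun
      | .qubit t _ => timeBasis t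
      | .state t _ => (timeBasis t).flip)
    WireLeg.spider WireLeg.mate
    (by
      rintro (⟨t, q⟩ | ⟨t, q⟩ | ⟨t, q⟩ | ⟨t, j⟩)
      · simp [WireLeg.mate]
      · simp [WireLeg.mate]
      · by_cases h : q.1 = t
        · obtain ⟨i, j⟩ := q
          obtain rfl : i = t := h
          rw [WireLeg.mate_inner_self]
          rfl
        · rw [WireLeg.mate_inner_of_ne h, WireLeg.mate_inner_of_ne (hexPartner_fst _ _ h),
            hexPartner_hexPartner]
      · exact WireLeg.mate_inner_self t j)
    (by
      rintro (⟨t, q⟩ | ⟨t, q⟩ | ⟨t, q⟩ | ⟨t, j⟩)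
      · simp [WireLeg.mate]
      · simp [WireLeg.mate]
      · by_cases h : q.1 = t
        · simp [WireLeg.mate, h]
        · rw [WireLeg.mate_inner_of_ne h]
          simpa using hexPartner_ne _ _ h
      · simp [WireLeg.mate])
    (by
      rintro (⟨t, q⟩ | ⟨t, j⟩)
      · refine (Set.toFinite {.below t q, .above t q, .inner t q}).subset ?_
        rintro (_ | _ | _ | _) h <;> cases h <;> simp
      · refine (Set.toFinite {.outer t j}).subset ?_
        rintro (_ | _ | _ | _) h <;> cases h; simp)

/-- The removal of the two-legged spiders of the measurements of weight two. -/
theorem nonempty_identityRemoval_wireDiagram :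
    Nonempty (ZXDiagram.IdentityRemoval (cssDiagram doubleHexagon) wireDiagram) := by
  let sp : WireSpider → CSSSpider doubleHexagon
    | .qubit t q => .qubit t q
    | .state t j => .outcome t (hexCell t (t, j)) (hexCell_mem _ _)
  let lg : WireLeg → CSSLeg doubleHexagon
    | .below t q => .below t q
    | .above t q => .above t q
    | .inner t q => .inner t (hexCell t q) (hexCell_mem _ _) q (mem_hexCell _ _)
    | .outer t j => .outer t (hexCell t (t, j)) (hexCell_mem _ _) (t, j) (mem_hexCell _ _)
  have hout : ∀ (t : ℤ) S (hS : S ∈ (doubleHexagon t).supports) q (hq : q ∈ S),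
      CSSLeg.outer t S hS q hq ∈ Set.range lg → q.1 = t := by
    rintro t S hS q hq ⟨_ | _ | _ | ⟨t', j⟩, h⟩
    · cases h
    · cases h
    · cases h
    · simp only [lg, CSSLeg.outer.injEq] at h
      obtain ⟨rfl, -, rfl⟩ := h
      rfl
  have hinner : ∀ (t : ℤ) S (hS : S ∈ (doubleHexagon t).supports) q (hq : q ∈ S),
      CSSLeg.inner t S hS q hq = lg (.inner t q) := by
    intro t S hS q hq
    obtain rfl := eq_hexCell hS hq
    rfl
  have hstate : ∀ (t : ℤ) S (hS : S ∈ (doubleHexagon t).supports) q (_ : q ∈ S),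
      CSSSpider.outcome t S hS ∈ Set.range sp → q.1 = t := by
    rintro t S hS q hq ⟨_ | ⟨t', j⟩, h⟩
    · cases h
    · simp only [sp, CSSSpider.outcome.injEq] at h
      obtain ⟨rfl, rfl⟩ := h
      rw [mem_hexCell_self.1 hq]
  have hsp : Function.Injective sp := by
    rintro (⟨t, q⟩ | ⟨t, j⟩) (⟨t', q'⟩ | ⟨t', j'⟩) h
    · cases h; rfl
    · cases h
    · cases h
    · simp only [sp, CSSSpider.outcome.injEq] at h
      obtain ⟨rfl, h⟩ := h
      have h1 : ((t : ZMod 6), j) ∈ hexCell t (t, j') := h ▸ mem_hexCell _ _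
      rw [mem_hexCell_self] at h1
      cases h1
      rfl
  have hlg : Function.Injective lg := by
    rintro (⟨t, q⟩ | ⟨t, q⟩ | ⟨t, q⟩ | ⟨t, j⟩) (⟨t', q'⟩ | ⟨t', q'⟩ | ⟨t', q'⟩ | ⟨t', j'⟩) h
    all_goals first | cases h; done | skip
    · cases h; rfl
    · cases h; rfl
    · simp only [lg, CSSLeg.inner.injEq] at h
      obtain ⟨rfl, -, rfl⟩ := h
      rfl
    · simp only [lg, CSSLeg.outer.injEq] at h
      obtain ⟨rfl, -, h⟩ := h
      cases h
      rfl
  have houter : ∀ (t : ℤ) S (hS : S ∈ (doubleHexagon t).supports) q (hq : q ∈ S) r (hr : r ∈ S),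
      CSSLeg.outer t S hS q hq = CSSLeg.outer t S hS r hr → q = r := by
    intro t S hS q hq r hr h
    simpa using h
  exact ⟨{
    spider := sp
    leg := lg
    spider_injective := hsp
    leg_injective := hlg
    colour_spider := by
      rintro (⟨t, q⟩ | ⟨t, j⟩)
      · exact hexBasis_intCast t
      · exact congrArg Basis.flip (hexBasis_intCast t)
    phase_spider := fun _ => rfl
    node_leg := by rintro (_ | _ | _ | _) <;> rfl
    mate_leg := by
      rintro (⟨t, q⟩ | ⟨t, q⟩ | ⟨t, q⟩ | ⟨t, j⟩) h
      · rfl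
      · rfl
      · have hq : q.1 = t := hout _ _ _ _ _ h
        obtain ⟨i, j⟩ := q
        obtain rfl : i = t := hq
        change _ = lg (WireLeg.mate (.inner t (t, j)))
        rw [WireLeg.mate_inner_self]
        rfl
      · rfl
    removed_leg := by
      rintro (⟨t, q⟩ | ⟨t, q⟩ | ⟨t, S, hS, q, hq⟩ | ⟨t, S, hS, q, hq⟩) h
      · exact absurd ⟨.below t q, rfl⟩ h
      · exact absurd ⟨.above t q, rfl⟩ h
      · exact absurd ⟨.inner t q, (hinner t S hS q hq).symm⟩ h
      · refine ⟨.outcome t S hS, fun hs => h ?_, rfl⟩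
        have hq' := hstate t S hS q hq hs
        obtain ⟨i, j⟩ := q
        obtain rfl : i = t := hq'
        obtain rfl := eq_hexCell hS hq
        exact ⟨.outer t j, rfl⟩
    removed_spider := by
      rintro (⟨t, q⟩ | ⟨t, S, hS⟩) h
      · exact absurd ⟨.qubit t q, rfl⟩ h
      · refine ⟨rfl, ?_⟩
        obtain ⟨q, hq⟩ := supports_doubleHexagon_nonempty hS
        have hqt : q.1 ≠ t := by
          intro hqt
          obtain ⟨i, j⟩ := q
          obtain rfl : i = t := hqt
          obtain rfl := eq_hexCell hS hq
          exact h ⟨.state t j, rfl⟩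
        obtain rfl := eq_hexCell hS hq
        have hp : hexPartner t q ∈ hexCell t q := by simp [hexCell]
        refine ⟨.outer t _ hS q hq, .outer t _ hS (hexPartner t q) hp, ?_, fun l => ⟨?_, ?_⟩,
          .inner t q, .inner t (hexPartner t q), hinner _ _ hS _ _, hinner _ _ hS _ _,
          WireLeg.mate_inner_of_ne hqt⟩
        · exact fun e => hexPartner_ne _ _ hqt (houter _ _ _ _ _ _ _ e).symm
        · intro hl
          obtain ⟨t', q'⟩ | ⟨t', q'⟩ | ⟨t', S', hS', q', hq'⟩ | ⟨t', S', hS', q', hq'⟩ := l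
          · cases hl
          · cases hl
          · cases hl
          · cases hl
            simp only [hexCell, Finset.mem_insert, Finset.mem_singleton] at hq'
            rcases hq' with rfl | rfl
            · exact Or.inl rfl
            · exact Or.inr rfl
        · rintro (rfl | rfl) <;> rfl }⟩

/-! ### Cutting the world-lines at the single-qubit measurements -/

/-- The five timesteps from one measurement of a qubit of the double hexagon code on its own to the
next one. -/
inductive Layer
  | one
  | two
  | three
  | four
  | five

/-- The time that has passed since the qubit was measured on its own. -/
def Layer.time : Layer → ℤ
  | one => 1
  | two => 2
  | three => 3
  | four => 4
  | five => 5

/-- The spiders of the diagram in which the world-line of each qubit is cut at the times at which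
the qubit gets measured on its own. The piece of the world-lines of the qubits `(s, j)` between the
times `s` and `s + 6` consists of `qubit a s j` and of the one-legged `bot s j` and `top s j`. -/
inductive PieceSpider
  | qubit (a : Layer) (s : ℤ) (j : ZMod 2)
  | bot (s : ℤ) (j : ZMod 2)
  | top (s : ℤ) (j : ZMod 2)

/-- The half-wires of the diagram in which the world-lines are cut into pieces. -/
inductive PieceLeg
  | below (a : Layer) (s : ℤ) (j : ZMod 2)
  | above (a : Layer) (s : ℤ) (j : ZMod 2)
  | inner (a : Layer) (s : ℤ) (j : ZMod 2)
  | bot (s : ℤ) (j : ZMod 2)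
  | top (s : ℤ) (j : ZMod 2)

namespace PieceLeg

/-- The spider at which a half-wire is attached. -/
def spider : PieceLeg → PieceSpider
  | below a s j => .qubit a s j
  | above a s j => .qubit a s j
  | inner a s j => .qubit a s j
  | bot s j => .bot s j
  | top s j => .top s j

/-- The other half of a wire. -/
def mate : PieceLeg → PieceLeg
  | bot s j => below .one s j
  | below .one s j => bot s j
  | above .one s j => below .two s j
  | below .two s j => above .one s j
  | above .two s j => below .three s j
  | below .three s j => above .two s j
  | above .three s j => below .four s j
  | below .four s j => above .three s j
  | above .four s j => below .five s j
  | below .five s j => above .four s j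
  | above .five s j => top s j
  | top s j => above .five s j
  | inner .one s j => inner .two (s - 1) j
  | inner .two s j => inner .one (s + 1) j
  | inner .three s j => inner .three s (j + 1)
  | inner .four s j => inner .five (s - 1) j
  | inner .five s j => inner .four (s + 1) j

theorem mate_mate (l : PieceLeg) : l.mate.mate = l := by
  have h : ∀ j : ZMod 2, j + 1 + 1 = j := by decide
  rcases l with ⟨_ | _, s, j⟩ | ⟨_ | _, s, j⟩ | ⟨_ | _, s, j⟩ | ⟨s, j⟩ | ⟨s, j⟩ <;> simp [mate, h]

theorem mate_ne (l : PieceLeg) : l.mate ≠ l := by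
  rcases l with ⟨_ | _, s, j⟩ | ⟨_ | _, s, j⟩ | ⟨_ | _, s, j⟩ | ⟨s, j⟩ | ⟨s, j⟩ <;> simp [mate]

end PieceLeg

/-- The diagram in which the world-lines are cut into pieces. -/
noncomputable def pieceDiagram : ZXDiagram Empty :=
  .phaseFree PieceSpider PieceLeg
    (fun
      | .qubit a s _ => timeBasis (s + a.time)
      | .bot s _ => (timeBasis s).flip
      | .top s _ => (timeBasis s).flip)
    PieceLeg.spider PieceLeg.mate PieceLeg.mate_mate PieceLeg.mate_ne
    (by
      rintro (⟨a, s, j⟩ | ⟨s, j⟩ | ⟨s, j⟩)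
      · refine (Set.toFinite {.below a s j, .above a s j, .inner a s j}).subset ?_
        rintro (_ | _ | _ | _ | _) h <;> cases h <;> simp
      · refine (Set.toFinite {.bot s j}).subset ?_
        rintro (_ | _ | _ | _ | _) h <;> cases h
        simp
      · refine (Set.toFinite {.top s j}).subset ?_
        rintro (_ | _ | _ | _ | _) h <;> cases h
        simp)

theorem Layer.exists_eq_add_time (t : ℤ) (i : ZMod 6) (h : i ≠ t) :
    ∃ (a : Layer) (s : ℤ), t = s + a.time ∧ i = s := by
  have key : ∀ c : ZMod 6, c ≠ 0 → ∃ a : Layer, c = (a.time : ZMod 6) := by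
    intro c hc
    have : c = 1 ∨ c = 2 ∨ c = 3 ∨ c = 4 ∨ c = 5 := by revert c; decide
    rcases this with rfl | rfl | rfl | rfl | rfl
    exacts [⟨.one, rfl⟩, ⟨.two, rfl⟩, ⟨.three, rfl⟩, ⟨.four, rfl⟩, ⟨.five, rfl⟩]
  obtain ⟨a, ha⟩ := key (t - i) (sub_ne_zero.2 h.symm)
  refine ⟨a, t - a.time, by ring, ?_⟩
  push_cast
  rw [← ha]
  ring

theorem Layer.add_time_ne (a : Layer) (s : ℤ) : ((s : ZMod 6)) ≠ ((s + a.time : ℤ) : ZMod 6) := by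
  push_cast
  intro h
  have h := left_eq_add.1 h
  revert h
  cases a <;> decide

/-- The two starting times agree modulo six and differ by at most four. -/
theorem Layer.eq_of_add_time_eq {a a' : Layer} {s s' : ℤ} (h : s + a.time = s' + a'.time)
    (hs : (s : ZMod 6) = s') : a = a' ∧ s = s' := by
  rw [ZMod.intCast_eq_intCast_iff_dvd_sub] at hs
  cases a <;> cases a' <;> simp only [Layer.time] at h <;>
    first
    | exact ⟨rfl, by omega⟩
    | (exfalso; omega)

/-- The copying of the one-legged spiders of the measurements of weight one. -/
theorem nonempty_stateCopy_pieceDiagram :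
    Nonempty (ZXDiagram.StateCopy wireDiagram pieceDiagram) := by
  -- A spider at a cut has two remaining legs and hence two copies: `bot` on the wire that leaves
  -- it, starting a piece, and `top` on the wire that enters it, ending the piece begun six
  -- timesteps earlier.
  let og : PieceSpider → WireSpider
    | .qubit a s j => .qubit (s + a.time) (s, j)
    | .bot s j => .qubit s (s, j)
    | .top s j => .qubit (s + 6) (s, j)
  let lg : PieceLeg → WireLeg
    | .below a s j => .below (s + a.time) (s, j)
    | .above a s j => .above (s + a.time) (s, j)
    | .inner a s j => .inner (s + a.time) (s, j)
    | .bot s j => .above s (s, j)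
    | .top s j => .below (s + 6) (s, j)
  have hmod : ∀ s : ℤ, ((s + 6 : ℤ) : ZMod 6) = s := fun s => by
    push_cast
    rw [show (6 : ZMod 6) = 0 from rfl, add_zero]
  have hlg : Function.Injective lg := by
    rintro (⟨a, s, j⟩ | ⟨a, s, j⟩ | ⟨a, s, j⟩ | ⟨s, j⟩ | ⟨s, j⟩)
      (⟨a', s', j'⟩ | ⟨a', s', j'⟩ | ⟨a', s', j'⟩ | ⟨s', j'⟩ | ⟨s', j'⟩) h <;>
      simp only [lg, WireLeg.below.injEq, WireLeg.above.injEq, WireLeg.inner.injEq, Prod.mk.injEq,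
        reduceCtorEq] at h
    · obtain ⟨h1, h2, rfl⟩ := h
      obtain ⟨rfl, rfl⟩ := Layer.eq_of_add_time_eq h1 h2
      rfl
    · obtain ⟨h1, h2, rfl⟩ := h
      have := a.add_time_ne s
      rw [h1, hmod, h2] at this
      exact absurd rfl this
    · obtain ⟨h1, h2, rfl⟩ := h
      obtain ⟨rfl, rfl⟩ := Layer.eq_of_add_time_eq h1 h2
      rfl
    · obtain ⟨h1, h2, rfl⟩ := h
      have := a.add_time_ne s
      rw [h1, h2] at this
      exact absurd rfl this
    · obtain ⟨h1, h2, rfl⟩ := h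
      obtain ⟨rfl, rfl⟩ := Layer.eq_of_add_time_eq h1 h2
      rfl
    · obtain ⟨h1, h2, rfl⟩ := h
      have := a'.add_time_ne s'
      rw [← h1, h2] at this
      exact absurd rfl this
    · obtain ⟨rfl, -, rfl⟩ := h
      rfl
    · obtain ⟨h1, h2, rfl⟩ := h
      have := a'.add_time_ne s'
      rw [← h1, hmod, h2] at this
      exact absurd rfl this
    · obtain ⟨h1, -, rfl⟩ := h
      obtain rfl := add_right_cancel h1
      rfl
  have hinner : ∀ (a : Layer) (s : ℤ) j, WireLeg.mate (lg (.inner a s j)) =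
      .inner (s + a.time) (hexPartner ((s + a.time : ℤ)) (s, j)) := fun a s j =>
    WireLeg.mate_inner_of_ne (a.add_time_ne s)
  have hp : ∀ (s c : ZMod 6) j, hexPartner (s + c) (s, j) =
      if c = 0 then (s, j) else if c = 3 then (s, j + 1)
      else if c = 1 ∨ c = 4 then (s - 1, j) else (s + 1, j) := fun s c j => by
    simp only [hexPartner, add_sub_cancel_left]
  have hmate : ∀ l, WireLeg.mate (lg l) = lg l.mate := by
    rintro (⟨a, s, j⟩ | ⟨a, s, j⟩ | ⟨a, s, j⟩ | ⟨s, j⟩ | ⟨s, j⟩)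
    · cases a <;> simp only [lg, WireLeg.mate, PieceLeg.mate, Layer.time] <;> congr 1 <;> ring
    · cases a <;> simp only [lg, WireLeg.mate, PieceLeg.mate, Layer.time] <;> congr 1 <;> ring
    · rw [hinner, Int.cast_add, hp]
      cases a
      · change WireLeg.inner (s + 1) (s - 1, j) = WireLeg.inner (s - 1 + 2) ((s - 1 : ℤ), j)
        push_cast; congr 1; ring
      · change WireLeg.inner (s + 2) (s + 1, j) = WireLeg.inner (s + 1 + 1) ((s + 1 : ℤ), j)
        push_cast; congr 1; ring
      · rfl
      · change WireLeg.inner (s + 4) (s - 1, j) = WireLeg.inner (s - 1 + 5) ((s - 1 : ℤ), j)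
        push_cast; congr 1; ring
      · change WireLeg.inner (s + 5) (s + 1, j) = WireLeg.inner (s + 1 + 4) ((s + 1 : ℤ), j)
        push_cast; congr 1; ring
    · rfl
    · simp only [lg, WireLeg.mate, PieceLeg.mate, Layer.time]; congr 1; ring
  have hrange : ∀ l, l ∈ Set.range lg ↔ ¬ (∃ t j, l = .outer t j) ∧ ¬ ∃ t j, l.mate = .outer t j := by
    intro l
    constructor
    · rintro ⟨l, rfl⟩
      have hno : ∀ l, ¬ ∃ t j, lg l = .outer t j := by
        rintro (_ | _ | _ | _ | _) ⟨t, j, h⟩ <;> cases h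
      rw [hmate]
      exact ⟨hno l, hno _⟩
    · rintro ⟨h1, h2⟩
      obtain ⟨t, i, j⟩ | ⟨t, i, j⟩ | ⟨t, i, j⟩ | ⟨t, j⟩ := l
      · by_cases h : i = t
        · subst h
          refine ⟨.top (t - 6) j, ?_⟩
          have := hmod (t - 6)
          rw [sub_add_cancel] at this
          simp only [lg, sub_add_cancel, ← this]
        · obtain ⟨a, s, rfl, rfl⟩ := Layer.exists_eq_add_time t i h
          exact ⟨.below a s j, rfl⟩
      · by_cases h : i = t
        · subst h
          exact ⟨.bot t j, rfl⟩
        · obtain ⟨a, s, rfl, rfl⟩ := Layer.exists_eq_add_time t i h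
          exact ⟨.above a s j, rfl⟩
      · by_cases h : i = t
        · subst h
          exact absurd ⟨t, j, WireLeg.mate_inner_self t j⟩ h2
        · obtain ⟨a, s, rfl, rfl⟩ := Layer.exists_eq_add_time t i h
          exact ⟨.inner a s j, rfl⟩
      · exact absurd ⟨t, j, rfl⟩ h1
  have hog : ∀ (t : ℤ) j w, og w = .qubit t (t, j) → w = .bot t j ∨ w = .top (t - 6) j := by
    rintro t j (⟨a, s, j'⟩ | ⟨s, j'⟩ | ⟨s, j'⟩) h <;>
      simp only [og, WireSpider.qubit.injEq, Prod.mk.injEq] at h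
    · obtain ⟨rfl, h, -⟩ := h
      exact absurd h (a.add_time_ne s)
    · obtain ⟨rfl, -, rfl⟩ := h
      exact Or.inl rfl
    · obtain ⟨rfl, -, rfl⟩ := h
      right
      rw [add_sub_cancel_right]
  have hog' : ∀ (a : Layer) (s : ℤ) j w, og w = .qubit (s + a.time) (s, j) ↔ w = .qubit a s j := by
    intro a s j w
    constructor
    · obtain ⟨a', s', j'⟩ | ⟨s', j'⟩ | ⟨s', j'⟩ := w <;> intro h <;>
        simp only [og, WireSpider.qubit.injEq, Prod.mk.injEq] at h
      · obtain ⟨h1, h2, rfl⟩ := h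
        obtain ⟨rfl, rfl⟩ := Layer.eq_of_add_time_eq h1 h2
        rfl
      · obtain ⟨h1, h2, rfl⟩ := h
        have := a.add_time_ne s
        rw [← h1, h2] at this
        exact absurd rfl this
      · obtain ⟨h1, h2, rfl⟩ := h
        have := a.add_time_ne s
        rw [← h1, hmod, h2] at this
        exact absurd rfl this
    · rintro rfl
      rfl
  have hflip : ∀ b : Basis, b = b.flip.flip := by rintro (_ | _) <;> rfl
  exact ⟨{
    states := {l | ∃ t j, l = WireLeg.outer t j}
    origin := og
    leg := lg
    leg_injective := hlg
    mate_leg := hmate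
    node_leg := by rintro (_ | _ | _ | _ | _) <;> rfl
    range_leg := hrange
    mate_states := by
      rintro _ ⟨t, j, rfl⟩ ⟨t', j', h⟩
      cases h
    states_unique := by
      rintro _ ⟨t, j, rfl⟩ _ ⟨t', j', rfl⟩ h
      cases h
      rfl
    copied := by
      rintro _ ⟨t, j, rfl⟩
      refine ⟨.state t j, .qubit t (t, j), rfl, rfl, ?_, hflip _, smul_zero _, ?_, ?_⟩
      · rintro (_ | _ | _ | _) h <;> cases h
        rfl
      · rintro (_ | _ | _) h <;> cases h
      · intro w hw
        rcases hog t j w hw with rfl | rfl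
        · refine ⟨rfl, rfl, .bot t j, rfl, ?_⟩
          rintro (_ | _ | _ | _ | _) h <;> cases h
          rfl
        · refine ⟨congrArg Basis.flip (timeBasis_of_even_iff ?_), rfl, .top (t - 6) j, rfl, ?_⟩
          · rw [Int.even_iff, Int.even_iff]
            omega
          · rintro (_ | _ | _ | _ | _) h <;> cases h
            rfl
    unchanged := by
      rintro (⟨t, i, j⟩ | ⟨t, j⟩) h
      · by_cases hi : i = t
        · subst hi
          exact absurd rfl (h (.outer t j) ⟨t, j, rfl⟩).2
        · obtain ⟨a, s, rfl, rfl⟩ := Layer.exists_eq_add_time t i hi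
          exact ⟨.qubit a s j, fun w => hog' a s j w, rfl, rfl⟩
      · exact absurd rfl (h (.outer t j) ⟨t, j, rfl⟩).1 }⟩

/-! ### Fusing the ends and the middles of the pieces -/

/-- The spiders of the diagram that arises from `pieceDiagram` by fusion: on each piece of a
world-line one spider at each of the five timesteps, but `mid s` is shared by the pieces `(s, 0)` and
`(s, 1)`. -/
inductive FusedSpider
  | first (s : ℤ) (j : ZMod 2)
  | low (s : ℤ) (j : ZMod 2)
  | mid (s : ℤ)
  | high (s : ℤ) (j : ZMod 2)
  | last (s : ℤ) (j : ZMod 2)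

/-- The half-wires of the diagram that arises from `pieceDiagram` by fusion. -/
inductive FusedLeg
  | firstAbove (s : ℤ) (j : ZMod 2)
  | firstInner (s : ℤ) (j : ZMod 2)
  | lowBelow (s : ℤ) (j : ZMod 2)
  | lowAbove (s : ℤ) (j : ZMod 2)
  | lowInner (s : ℤ) (j : ZMod 2)
  | midBelow (s : ℤ) (j : ZMod 2)
  | midAbove (s : ℤ) (j : ZMod 2)
  | highBelow (s : ℤ) (j : ZMod 2)
  | highAbove (s : ℤ) (j : ZMod 2)
  | highInner (s : ℤ) (j : ZMod 2)
  | lastBelow (s : ℤ) (j : ZMod 2)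
  | lastInner (s : ℤ) (j : ZMod 2)

namespace FusedLeg

/-- The spider at which a half-wire is attached. -/
def spider : FusedLeg → FusedSpider
  | firstAbove s j => .first s j
  | firstInner s j => .first s j
  | lowBelow s j => .low s j
  | lowAbove s j => .low s j
  | lowInner s j => .low s j
  | midBelow s _ => .mid s
  | midAbove s _ => .mid s
  | highBelow s j => .high s j
  | highAbove s j => .high s j
  | highInner s j => .high s j
  | lastBelow s j => .last s j
  | lastInner s j => .last s j

/-- The other half of a wire. -/
def mate : FusedLeg → FusedLeg
  | firstAbove s j => lowBelow s j
  | firstInner s j => lowInner (s - 1) j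
  | lowBelow s j => firstAbove s j
  | lowAbove s j => midBelow s j
  | lowInner s j => firstInner (s + 1) j
  | midBelow s j => lowAbove s j
  | midAbove s j => highBelow s j
  | highBelow s j => midAbove s j
  | highAbove s j => lastBelow s j
  | highInner s j => lastInner (s - 1) j
  | lastBelow s j => highAbove s j
  | lastInner s j => highInner (s + 1) j

end FusedLeg

/-- The diagram that arises from `pieceDiagram` by fusion. -/
noncomputable def fusedDiagram : ZXDiagram Empty :=
  .phaseFree FusedSpider FusedLeg
    (fun
      | .first s _ => timeBasis (s + 1)
      | .low s _ => timeBasis (s + 2)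
      | .mid s => timeBasis (s + 3)
      | .high s _ => timeBasis (s + 4)
      | .last s _ => timeBasis (s + 5))
    FusedLeg.spider FusedLeg.mate
    (by rintro (_ | _) <;> simp [FusedLeg.mate])
    (by rintro (_ | _) <;> simp [FusedLeg.mate])
    (by
      rintro (⟨s, j⟩ | ⟨s, j⟩ | s | ⟨s, j⟩ | ⟨s, j⟩)
      · refine (Set.toFinite {.firstAbove s j, .firstInner s j}).subset ?_
        rintro (_ | _) h <;> cases h <;> simp
      · refine (Set.toFinite {.lowBelow s j, .lowAbove s j, .lowInner s j}).subset ?_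
        rintro (_ | _) h <;> cases h <;> simp
      · refine (Set.toFinite (Set.range (FusedLeg.midBelow s) ∪
          Set.range (FusedLeg.midAbove s))).subset ?_
        rintro (_ | _) h <;> cases h <;> simp
      · refine (Set.toFinite {.highBelow s j, .highAbove s j, .highInner s j}).subset ?_
        rintro (_ | _) h <;> cases h <;> simp
      · refine (Set.toFinite {.lastBelow s j, .lastInner s j}).subset ?_
        rintro (_ | _) h <;> cases h <;> simp)

/-- The fusion of the one-legged spiders and of the measurements of weight two in the middle of the
pieces. -/
theorem nonempty_spiderFusion_fusedDiagram :
    Nonempty (ZXDiagram.SpiderFusion pieceDiagram fusedDiagram) := by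
  -- The ends are coloured opposite to time `s`, which is the colour of the odd times `s + 1` and `s
  -- + 5` of the piece. The middle spiders are joined by the measurement of `(s, 0)` and `(s, 1)` at
  -- time `s + 3`.
  let sp : PieceSpider → FusedSpider
    | .bot s j => .first s j
    | .qubit .one s j => .first s j
    | .qubit .two s j => .low s j
    | .qubit .three s _ => .mid s
    | .qubit .four s j => .high s j
    | .qubit .five s j => .last s j
    | .top s j => .last s j
  let lg : FusedLeg → PieceLeg
    | .firstAbove s j => .above .one s j
    | .firstInner s j => .inner .one s j
    | .lowBelow s j => .below .two s j
    | .lowAbove s j => .above .two s j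
    | .lowInner s j => .inner .two s j
    | .midBelow s j => .below .three s j
    | .midAbove s j => .above .three s j
    | .highBelow s j => .below .four s j
    | .highAbove s j => .above .four s j
    | .highInner s j => .inner .four s j
    | .lastBelow s j => .below .five s j
    | .lastInner s j => .inner .five s j
  have hlg : Function.Injective lg := by
    rintro (_ | _) (_ | _) h <;> cases h <;> rfl
  have hfin : ∀ w, {v | sp v = w}.Finite := by
    rintro (⟨s, j⟩ | ⟨s, j⟩ | s | ⟨s, j⟩ | ⟨s, j⟩)
    · refine (Set.toFinite {.bot s j, .qubit .one s j}).subset ?_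
      rintro (⟨_ | _, s, j⟩ | ⟨s, j⟩ | ⟨s, j⟩) h <;> cases h <;> simp
    · refine (Set.toFinite {.qubit .two s j}).subset ?_
      rintro (⟨_ | _, s, j⟩ | ⟨s, j⟩ | ⟨s, j⟩) h <;> cases h
      simp
    · refine (Set.toFinite (Set.range (PieceSpider.qubit .three s))).subset ?_
      rintro (⟨_ | _, s, j⟩ | ⟨s, j⟩ | ⟨s, j⟩) h <;> cases h
      simp
    · refine (Set.toFinite {.qubit .four s j}).subset ?_
      rintro (⟨_ | _, s, j⟩ | ⟨s, j⟩ | ⟨s, j⟩) h <;> cases h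
      simp
    · refine (Set.toFinite {.top s j, .qubit .five s j}).subset ?_
      rintro (⟨_ | _, s, j⟩ | ⟨s, j⟩ | ⟨s, j⟩) h <;> cases h <;> simp
  have hremoved : (∀ s j, .bot s j ∉ Set.range lg) ∧ (∀ s j, .below .one s j ∉ Set.range lg) ∧
      (∀ s j, .inner .three s j ∉ Set.range lg) ∧ (∀ s j, .above .five s j ∉ Set.range lg) ∧
      ∀ s j, .top s j ∉ Set.range lg := by
    refine ⟨?_, ?_, ?_, ?_, ?_⟩ <;> rintro s j ⟨_ | _, h⟩ <;> cases h
  obtain ⟨hbot, hbelow, hinner, habove, htop⟩ := hremoved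
  have hj : ∀ j j' : ZMod 2, j = j' ∨ j' = j + 1 := by decide
  exact ⟨{
    spider := sp
    leg := lg
    spider_surjective := by
      rintro (⟨s, j⟩ | ⟨s, j⟩ | s | ⟨s, j⟩ | ⟨s, j⟩)
      exacts [⟨.qubit .one s j, rfl⟩, ⟨.qubit .two s j, rfl⟩, ⟨.qubit .three s 0, rfl⟩,
        ⟨.qubit .four s j, rfl⟩, ⟨.qubit .five s j, rfl⟩]
    leg_injective := hlg
    mate_leg := by rintro (_ | _) <;> rfl
    node_leg := by rintro (_ | _) <;> rfl
    colour_spider := by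
      rintro (⟨_ | _, s, j⟩ | ⟨s, j⟩ | ⟨s, j⟩)
      any_goals rfl
      · exact (timeBasis_flip_of_even_iff (by rw [Int.even_add_one, not_not])).symm
      · refine (timeBasis_flip_of_even_iff ?_).symm
        rw [Int.even_iff, Int.even_iff]
        omega
    finite_fibre := hfin
    phase_eq := fun w => (finsum_mem_zero _).symm
    removed := by
      rintro (⟨_ | _, s, j⟩ | ⟨_ | _, s, j⟩ | ⟨_ | _, s, j⟩ | ⟨s, j⟩ | ⟨s, j⟩) h
      · exact ⟨_, _, rfl, rfl, rfl⟩
      · exact absurd ⟨.lowBelow s j, rfl⟩ h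
      · exact absurd ⟨.midBelow s j, rfl⟩ h
      · exact absurd ⟨.highBelow s j, rfl⟩ h
      · exact absurd ⟨.lastBelow s j, rfl⟩ h
      · exact absurd ⟨.firstAbove s j, rfl⟩ h
      · exact absurd ⟨.lowAbove s j, rfl⟩ h
      · exact absurd ⟨.midAbove s j, rfl⟩ h
      · exact absurd ⟨.highAbove s j, rfl⟩ h
      · exact ⟨_, _, rfl, rfl, rfl⟩
      · exact absurd ⟨.firstInner s j, rfl⟩ h
      · exact absurd ⟨.lowInner s j, rfl⟩ h
      · exact ⟨_, _, rfl, rfl, rfl⟩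
      · exact absurd ⟨.highInner s j, rfl⟩ h
      · exact absurd ⟨.lastInner s j, rfl⟩ h
      · exact ⟨_, _, rfl, rfl, rfl⟩
      · exact ⟨_, _, rfl, rfl, rfl⟩
    connected := by
      rintro (⟨_ | _, s, j⟩ | ⟨s, j⟩ | ⟨s, j⟩) (⟨_ | _, s', j'⟩ | ⟨s', j'⟩ | ⟨s', j'⟩) h <;> cases h
      any_goals exact .refl
      · exact .single ⟨.below .one s j, hbelow s j, rfl, rfl⟩
      · rcases hj j j' with rfl | rfl
        · exact .refl
        · exact .single ⟨.inner .three s j, hinner s j, rfl, rfl⟩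
      · exact .single ⟨.above .five s j, habove s j, rfl, rfl⟩
      · exact .single ⟨.bot s j, hbot s j, rfl, rfl⟩
      · exact .single ⟨.top s j, htop s j, rfl, rfl⟩ }⟩

/-! ### Reading off the diagram of the `[[4,2,2]]` code -/

/-- The qubits of the `[[4,2,2]]` code whose world-lines arise from the `low` spiders. -/
def lowQubit (j : ZMod 2) : Fin 4 := if j = 0 then 0 else 1

/-- The qubits of the `[[4,2,2]]` code whose world-lines arise from the `high` spiders. -/
def highQubit (j : ZMod 2) : Fin 4 := if j = 0 then 2 else 3

theorem code422_supports {t : ZMod 2} {S : Finset (Fin 4)} (h : S ∈ (code422 t).supports) :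
    S = Finset.univ := Finset.mem_singleton.1 h

/-- The spider of `fusedDiagram` on the world-line of `q` in the diagram of the `[[4,2,2]]` code. -/
def fusedQubit (s : ℤ) : Fin 4 → FusedSpider
  | 0 => .low s 0
  | 1 => .low s 1
  | 2 => .high s 0
  | 3 => .high s 1

/-- The half-wire of `fusedDiagram` at which the world-line of `q` enters `fusedQubit s q`. -/
def fusedBelow (s : ℤ) : Fin 4 → FusedLeg
  | 0 => .lowBelow s 0
  | 1 => .lowBelow s 1
  | 2 => .highInner s 0
  | 3 => .highInner s 1

/-- The half-wire of `fusedDiagram` at which the world-line of `q` leaves `fusedQubit s q`. -/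
def fusedAbove (s : ℤ) : Fin 4 → FusedLeg
  | 0 => .lowInner s 0
  | 1 => .lowInner s 1
  | 2 => .highAbove s 0
  | 3 => .highAbove s 1

/-- The half-wire at `fusedQubit s q` that leads to `mid s`. -/
def fusedInner (s : ℤ) : Fin 4 → FusedLeg
  | 0 => .lowAbove s 0
  | 1 => .lowAbove s 1
  | 2 => .highBelow s 0
  | 3 => .highBelow s 1

/-- The half-wire at `mid s` that leads to `fusedQubit s q`. -/
def fusedOuter (s : ℤ) : Fin 4 → FusedLeg
  | 0 => .midBelow s 0
  | 1 => .midBelow s 1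
  | 2 => .midAbove s 0
  | 3 => .midAbove s 1

theorem forall_fin_four {P : Fin 4 → Prop} : (∀ q, P q) ↔ P 0 ∧ P 1 ∧ P 2 ∧ P 3 := by
  simp [Fin.forall_fin_succ]

theorem forall_zmod_two {P : ZMod 2 → Prop} : (∀ j, P j) ↔ P 0 ∧ P 1 := Fin.forall_fin_two

/-- The spider of `fusedDiagram` that corresponds to a spider of the `[[4,2,2]]` code. -/
def fusedSpiderOf : CSSSpider code422 → FusedSpider
  -- The colours of `low s` and `high s` have the parity of `s`, while the qubit spiders at time `t`
  -- have that of `t + 1`.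
  | .qubit t q => fusedQubit (t + 1) q
  | .outcome t _ _ => .mid (t + 1)

/-- The half-wire of `fusedDiagram` that corresponds to a half-wire of the `[[4,2,2]]` code. -/
def fusedLegOf : CSSLeg code422 → FusedLeg
  | .below t q => fusedBelow (t + 1) q
  | .above t q => fusedAbove (t + 1) q
  | .inner t _ _ q _ => fusedInner (t + 1) q
  | .outer t _ _ q _ => fusedOuter (t + 1) q

theorem fusedSpiderOf_injective : Function.Injective fusedSpiderOf := by
  let f : FusedSpider → Option (ℤ × Fin 4)
    | .low s j => some (s, lowQubit j)
    | .high s j => some (s, highQubit j)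
    | _ => none
  have hf : ∀ s q, f (fusedQubit s q) = some (s, q) := by
    intro s
    rw [forall_fin_four]
    exact ⟨rfl, rfl, rfl, rfl⟩
  rintro (⟨t, q⟩ | ⟨t, S, hS⟩) (⟨t', q'⟩ | ⟨t', S', hS'⟩) h
  · have h := congrArg f h
    change f (fusedQubit _ _) = f (fusedQubit _ _) at h
    rw [hf, hf] at h
    simp only [Option.some.injEq, Prod.mk.injEq, add_left_inj] at h
    rw [h.1, h.2]
  · have h := congrArg f h
    change f (fusedQubit _ _) = none at h
    rw [hf] at h
    cases h
  · have h := congrArg f h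
    change none = f (fusedQubit _ _) at h
    rw [hf] at h
    cases h
  · obtain rfl : t = t' := add_right_cancel (FusedSpider.mid.inj h)
    obtain rfl := code422_supports hS
    obtain rfl := code422_supports hS'
    rfl

theorem fusedLegOf_injective : Function.Injective fusedLegOf := by
  -- This decodes the kind of half-wire, the time and the qubit; `4` is a dummy kind for the legs of
  -- `first` and `last`.
  let f : FusedLeg → ℕ × ℤ × Fin 4
    | .lowBelow s j => (0, s, lowQubit j)
    | .highInner s j => (0, s, highQubit j)
    | .lowInner s j => (1, s, lowQubit j)
    | .highAbove s j => (1, s, highQubit j)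
    | .lowAbove s j => (2, s, lowQubit j)
    | .highBelow s j => (2, s, highQubit j)
    | .midBelow s j => (3, s, lowQubit j)
    | .midAbove s j => (3, s, highQubit j)
    | _ => (4, 0, 0)
  have hf : ∀ s q, f (fusedBelow s q) = (0, s, q) ∧ f (fusedAbove s q) = (1, s, q) ∧
      f (fusedInner s q) = (2, s, q) ∧ f (fusedOuter s q) = (3, s, q) := by
    intro s
    rw [forall_fin_four]
    exact ⟨⟨rfl, rfl, rfl, rfl⟩, ⟨rfl, rfl, rfl, rfl⟩, ⟨rfl, rfl, rfl, rfl⟩, rfl, rfl, rfl, rfl⟩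
  rintro (⟨t, q⟩ | ⟨t, q⟩ | ⟨t, S, hS, q, hq⟩ | ⟨t, S, hS, q, hq⟩)
    (⟨t', q'⟩ | ⟨t', q'⟩ | ⟨t', S', hS', q', hq'⟩ | ⟨t', S', hS', q', hq'⟩) h <;>
    have h := congrArg f h <;>
    simp only [fusedLegOf, hf, Prod.mk.injEq, add_left_inj, OfNat.ofNat_ne_zero, OfNat.zero_ne_ofNat,
      OfNat.ofNat_ne_one, OfNat.one_ne_ofNat, zero_ne_one, one_ne_zero, false_and, true_and,
      Nat.reduceEqDiff] at h
  · rw [h.1, h.2]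
  · rw [h.1, h.2]
  · obtain ⟨rfl, rfl⟩ := h
    obtain rfl := code422_supports hS
    obtain rfl := code422_supports hS'
    rfl
  · obtain ⟨rfl, rfl⟩ := h
    obtain rfl := code422_supports hS
    obtain rfl := code422_supports hS'
    rfl

theorem notMem_range_fusedSpiderOf (s : ℤ) (j : ZMod 2) :
    .first s j ∉ Set.range fusedSpiderOf ∧ .last s j ∉ Set.range fusedSpiderOf := by
  have hq : ∀ t q, fusedQubit t q ≠ .first s j ∧ fusedQubit t q ≠ .last s j := by
    intro t
    rw [forall_fin_four]
    exact ⟨⟨nofun, nofun⟩, ⟨nofun, nofun⟩, ⟨nofun, nofun⟩, nofun, nofun⟩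
  constructor
  · rintro ⟨⟨t, q⟩ | ⟨t, S, hS⟩, h⟩
    · exact (hq _ _).1 h
    · cases h
  · rintro ⟨⟨t, q⟩ | ⟨t, S, hS⟩, h⟩
    · exact (hq _ _).2 h
    · cases h

theorem spider_fusedLegOf (l : CSSLeg code422) :
    (fusedLegOf l).spider = fusedSpiderOf l.spider := by
  have hq : ∀ t q, ((fusedBelow t q).spider = fusedQubit t q ∧
      (fusedAbove t q).spider = fusedQubit t q ∧ (fusedInner t q).spider = fusedQubit t q) ∧
      (fusedOuter t q).spider = .mid t := by
    intro t
    rw [forall_fin_four]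
    exact ⟨⟨⟨rfl, rfl, rfl⟩, rfl⟩, ⟨⟨rfl, rfl, rfl⟩, rfl⟩, ⟨⟨rfl, rfl, rfl⟩, rfl⟩, ⟨rfl, rfl, rfl⟩,
      rfl⟩
  obtain ⟨t, q⟩ | ⟨t, q⟩ | ⟨t, S, hS, q, _⟩ | ⟨t, S, hS, q, _⟩ := l
  exacts [(hq _ _).1.1, (hq _ _).1.2.1, (hq _ _).1.2.2, (hq _ q).2]

theorem notMem_range_fusedLegOf (l : FusedLeg)
    (h : (∃ s j, l.spider = .first s j) ∨ ∃ s j, l.spider = .last s j) :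
    l ∉ Set.range fusedLegOf := by
  rintro ⟨m, rfl⟩
  rw [spider_fusedLegOf] at h
  rcases h with ⟨s, j, h⟩ | ⟨s, j, h⟩
  · exact (notMem_range_fusedSpiderOf s j).1 ⟨_, h⟩
  · exact (notMem_range_fusedSpiderOf s j).2 ⟨_, h⟩

/-- Along a world-line every wire of `fusedDiagram` leads to a spider about to be removed, so the
hypothesis fails there; only the wires to `mid` have to be compared. -/
theorem mate_fusedLegOf (l : CSSLeg code422)
    (h : (fusedLegOf l).mate ∈ Set.range fusedLegOf) :
    (fusedLegOf l).mate = fusedLegOf l.mate := by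
  have hq : ∀ t q, (fusedInner t q).mate = fusedOuter t q ∧ (fusedOuter t q).mate = fusedInner t q ∧
      (fusedBelow t q).mate ∉ Set.range fusedLegOf ∧
      (fusedAbove t q).mate ∉ Set.range fusedLegOf := by
    have hfirst := fun l s j h => notMem_range_fusedLegOf l (Or.inl ⟨s, j, h⟩)
    have hlast := fun l s j h => notMem_range_fusedLegOf l (Or.inr ⟨s, j, h⟩)
    intro t
    rw [forall_fin_four]
    exact ⟨⟨rfl, rfl, hfirst _ _ _ rfl, hfirst _ _ _ rfl⟩,
      ⟨rfl, rfl, hfirst _ _ _ rfl, hfirst _ _ _ rfl⟩,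
      ⟨rfl, rfl, hlast _ _ _ rfl, hlast _ _ _ rfl⟩,
      rfl, rfl, hlast _ _ _ rfl, hlast _ _ _ rfl⟩
  obtain ⟨t, q⟩ | ⟨t, q⟩ | ⟨t, S, hS, q, _⟩ | ⟨t, S, hS, q, _⟩ := l
  · exact absurd h (hq _ q).2.2.1
  · exact absurd h (hq _ q).2.2.2
  · exact (hq _ q).1
  · exact (hq _ q).2.1

/-- The removal of the remaining two-legged spiders. -/
theorem nonempty_identityRemoval_code422 :
    Nonempty (ZXDiagram.IdentityRemoval fusedDiagram (cssDiagram code422)) := by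
  have hS : ∀ t : ZMod 2, Finset.univ ∈ (code422 t).supports := fun t => Finset.mem_singleton_self _
  have hlow : ∀ s j, fusedBelow s (lowQubit j) = .lowBelow s j ∧
      fusedAbove s (lowQubit j) = .lowInner s j ∧ fusedInner s (lowQubit j) = .lowAbove s j ∧
      fusedOuter s (lowQubit j) = .midBelow s j ∧ fusedQubit s (lowQubit j) = .low s j := by
    intro s
    rw [forall_zmod_two]
    exact ⟨⟨rfl, rfl, rfl, rfl, rfl⟩, rfl, rfl, rfl, rfl, rfl⟩
  have hhigh : ∀ s j, fusedBelow s (highQubit j) = .highInner s j ∧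
      fusedAbove s (highQubit j) = .highAbove s j ∧ fusedInner s (highQubit j) = .highBelow s j ∧
      fusedOuter s (highQubit j) = .midAbove s j ∧ fusedQubit s (highQubit j) = .high s j := by
    intro s
    rw [forall_zmod_two]
    exact ⟨⟨rfl, rfl, rfl, rfl, rfl⟩, rfl, rfl, rfl, rfl, rfl⟩
  have hbelow : ∀ s q, fusedLegOf (.below (s - 1) q) = fusedBelow s q :=
    fun s q => by simp [fusedLegOf]
  have habove : ∀ s q, fusedLegOf (.above (s - 1) q) = fusedAbove s q :=
    fun s q => by simp [fusedLegOf]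
  have hinner : ∀ s q, fusedLegOf (.inner (s - 1) _ (hS _) q (Finset.mem_univ q)) = fusedInner s q :=
    fun s q => by simp [fusedLegOf]
  have houter : ∀ s q, fusedLegOf (.outer (s - 1) _ (hS _) q (Finset.mem_univ q)) = fusedOuter s q :=
    fun s q => by simp [fusedLegOf]
  exact ⟨{
    spider := fusedSpiderOf
    leg := fusedLegOf
    spider_injective := fusedSpiderOf_injective
    leg_injective := fusedLegOf_injective
    colour_spider := by
      rintro (⟨t, q⟩ | ⟨t, S, hS⟩)
      · refine Eq.trans ?_ (code422_basis_intCast t).symm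
        revert q
        rw [forall_fin_four]
        refine ⟨?_, ?_, ?_, ?_⟩ <;>
          refine timeBasis_of_even_iff ?_ <;> rw [Int.even_iff, Int.even_iff] <;> omega
      · refine Eq.trans ?_ (congrArg Basis.flip (code422_basis_intCast t).symm)
        refine (timeBasis_flip_of_even_iff ?_).symm
        rw [Int.even_iff, Int.even_iff]
        omega
    phase_spider := fun _ => rfl
    node_leg := fun l => congrArg Sum.inl (spider_fusedLegOf l)
    mate_leg := mate_fusedLegOf
    removed_leg := by
      rintro (⟨s, j⟩ | ⟨s, j⟩ | ⟨s, j⟩ | ⟨s, j⟩ | ⟨s, j⟩ | ⟨s, j⟩ | ⟨s, j⟩ | ⟨s, j⟩ | ⟨s, j⟩ |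
        ⟨s, j⟩ | ⟨s, j⟩ | ⟨s, j⟩) h
      · exact ⟨_, (notMem_range_fusedSpiderOf s j).1, rfl⟩
      · exact ⟨_, (notMem_range_fusedSpiderOf s j).1, rfl⟩
      · exact absurd ⟨_, (hbelow s _).trans (hlow s j).1⟩ h
      · exact absurd ⟨_, (hinner s _).trans (hlow s j).2.2.1⟩ h
      · exact absurd ⟨_, (habove s _).trans (hlow s j).2.1⟩ h
      · exact absurd ⟨_, (houter s _).trans (hlow s j).2.2.2.1⟩ h
      · exact absurd ⟨_, (houter s _).trans (hhigh s j).2.2.2.1⟩ h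
      · exact absurd ⟨_, (hinner s _).trans (hhigh s j).2.2.1⟩ h
      · exact absurd ⟨_, (habove s _).trans (hhigh s j).2.1⟩ h
      · exact absurd ⟨_, (hbelow s _).trans (hhigh s j).1⟩ h
      · exact ⟨_, (notMem_range_fusedSpiderOf s j).2, rfl⟩
      · exact ⟨_, (notMem_range_fusedSpiderOf s j).2, rfl⟩
    removed_spider := by
      have hne : ∀ s j, FusedLeg.firstAbove s j ≠ .firstInner s j ∧
          FusedLeg.lastBelow s j ≠ .lastInner s j := fun s j => ⟨nofun, nofun⟩
      rintro (⟨s, j⟩ | ⟨s, j⟩ | s | ⟨s, j⟩ | ⟨s, j⟩) h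
      -- `first s j` lies on a world-line between `low (s - 1) j` and `low s j`.
      · refine ⟨rfl, .firstAbove s j, .firstInner s j, (hne s j).1, fun l => ⟨?_, ?_⟩,
          .below (s - 1) (lowQubit j), .above (s - 1 - 1) (lowQubit j),
          ((hbelow s _).trans (hlow s j).1).symm, ((habove _ _).trans (hlow _ j).2.1).symm, rfl⟩
        · intro hl
          cases l <;> cases hl
          · exact Or.inl rfl
          · exact Or.inr rfl
        · rintro (rfl | rfl) <;> rfl
      · exact absurd ⟨.qubit (s - 1) (lowQubit j), by
          simp only [fusedSpiderOf, sub_add_cancel]; exact (hlow s j).2.2.2.2⟩ h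
      · exact absurd ⟨.outcome (s - 1) Finset.univ (hS _),
          congrArg FusedSpider.mid (sub_add_cancel s 1)⟩ h
      · exact absurd ⟨.qubit (s - 1) (highQubit j), by
          simp only [fusedSpiderOf, sub_add_cancel]; exact (hhigh s j).2.2.2.2⟩ h
      -- `last s j` lies on a world-line between `high s j` and `high (s + 1) j`.
      · refine ⟨rfl, .lastBelow s j, .lastInner s j, (hne s j).2, fun l => ⟨?_, ?_⟩,
          .above (s - 1) (highQubit j), .below (s - 1 + 1) (highQubit j),
          ((habove s _).trans (hhigh s j).2.1).symm, ?_, rfl⟩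
        · intro hl
          cases l <;> cases hl
          · exact Or.inl rfl
          · exact Or.inr rfl
        · rintro (rfl | rfl) <;> rfl
        · rw [sub_add_cancel]
          exact (hhigh (s + 1) j).1.symm }⟩

theorem equivalent_code422_doubleHexagon :
    (cssDiagram code422).Equivalent (cssDiagram doubleHexagon) := by
  refine .symm _ _ (.trans _ wireDiagram _ (.rel _ _ ?_) (.trans _ pieceDiagram _ (.rel _ _ ?_)
    (.trans _ fusedDiagram _ (.rel _ _ ?_) (.rel _ _ ?_))))
  · exact Or.inr (Or.inl nonempty_identityRemoval_wireDiagram)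
  · exact Or.inr (Or.inr nonempty_stateCopy_pieceDiagram)
  · exact Or.inl nonempty_spiderFusion_fusedDiagram
  · exact Or.inr (Or.inl nonempty_identityRemoval_code422)

theorem theorem3p1 :
    -- the `[[4,2,2]]` stabilizer code
    IsStabilizerSchedule (cssSchedule code422) ∧
    IsISGCode (cssSchedule code422) 1 4 2 2 ∧
    -- the double hexagon code is a `[[12,2,2]]` Floquet code of period 6, established from `t = 3`
    IsISGCode (cssSchedule doubleHexagon) 3 12 2 2 ∧
    HasPeriod (cssSchedule doubleHexagon) 6 ∧
    -- all of its measurements have weight one or two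
    (∀ t, ∀ p ∈ (doubleHexagon t).paulis, p.weight = 1 ∨ p.weight = 2) ∧
    -- up to signs, its ISG is minimally generated by the seven generators of `M t` and by
    -- `s (t - 1)`, `s (t - 2)`, `s (t - 3)`
    (∀ ρ : Run (cssSchedule doubleHexagon), ∀ t : ℤ, 3 ≤ t →
      Group.rank (ρ.isg t) = 10 ∧
      ((doubleHexagon t).paulis ∪
        {hexStabilizer (t - 1), hexStabilizer (t - 2), hexStabilizer (t - 3)}).ncard = 10 ∧
      ∃ ε : Pauli (ZMod 6 × ZMod 2) → ℤˣ,
        ρ.isg t = Subgroup.closure ((fun p => p.signed (ε p)) ''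
          ((doubleHexagon t).paulis ∪
            {hexStabilizer (t - 1), hexStabilizer (t - 2), hexStabilizer (t - 3)}))) ∧
    -- the two codes are equivalent as ZX-diagrams
    (cssDiagram code422).Equivalent (cssDiagram doubleHexagon) := by
  refine ⟨isStabilizerSchedule_code422, isISGCode_code422, isISGCode_doubleHexagon,
    hasPeriod_doubleHexagon, fun t => weight_of_mem_paulis_doubleHexagon t, doubleHexagon_isg,
    equivalent_code422_doubleHexagon⟩
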